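/- Let $n,m\ge 1$ be integers, let $1<p_1,\dots,p_m<\infty$, $\vec P=(p_1,\dots,p_m)$, $\frac1p=\frac1{p_1}+\cdots+\frac1{p_m}$, $0<\alpha<mn$, $\frac1m<p<\frac n\alpha$ and $\frac1q=\frac1p-\frac\alpha n$. Write $p_i'=p_i/(p_i-1)$; cubes are nondegenerate cubes $Q\subset\mathbb R^n$ with sides parallel to the axes. For locally integrable $f_1,\dots,f_m$ on $\mathbb R^n$ put $$\mathcal M_\alpha(\vec f)(x)=\sup_{Q\ni x}\prod_{i=1}^m\frac1{|Q|^{1-\frac{\alpha}{mn}}}\int_Q|f_i(y)|\,dy .$$ For a vector $\vec\omega=(\omega_1,\dots,\omega_m)$ of nonnegative measurable functions on $\mathbb R^n$ put $\nu_{\vec\omega}=\prod_{i=1}^m\omega_i$, $\sigma_i=\omega_i^{-p_i'}$, and $$[\vec\omega]_{A_{(\vec P,q)}}=\sup_Q\Big(\frac1{|Q|}\int_Q\nu_{\vec\omega}^q\Big)\prod_{i=1}^m\Big(\frac1{|Q|}\int_Q\omega_i^{-p_i'}\Big)^{q/p_i'} ;$$ $\vec\omega\in A_{(\vec P,q)}$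 means that $\sup_Q\big(\frac1{|Q|}\int_Q\nu_{\vec\omega}^q\big)^{1/q}\prod_{i=1}^m\big(\frac1{|Q|}\int_Q\omega_i^{-p_i'}\big)^{1/p_i'}<\infty$, that is, $[\vec\omega]_{A_{(\vec P,q)}}<\infty$. For a weight $\sigma$ put $$[\sigma]_{A_\infty}=\sup_Q\frac1{\sigma(Q)}\int_Q M(\sigma\chi_Q)(x)\,dx,\qquad \sigma(Q)=\int_Q\sigma,\qquad M g(x)=\sup_{Q\ni x}\frac1{|Q|}\int_Q|g| .$$ (All these quantities take values in $[0,\infty]$, with $0^{-p_i'}=\infty$ and $0\cdot\infty=0$.) Then there is a finite constant $C=C_{n,m,\vec P,q}$ such that, for all $\vec\omega\in A_{(\vec P,q)}$ and all locally integrable $f_1,\dots,f_m$, $$\|\mathcal M_\alpha(\vec f)\|_{L^q(\nu_{\vec\omega}^q)}\le C\,[\vec\omega]_{A_{(\vec P,q)}}^{1/q}\prod_{i=1}^m[\sigma_i]_{A_\infty}^{1/p_i}\prod_{i=1}^m\|f_i\|_{L^{p_i}(\omega_i^{p_i})}.$$ -/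

import Mathlib

open MeasureTheory
open scoped NNReal ENNReal

noncomputable section

namespace MultilinearFractional

/-- A (closed, nondegenerate) cube of `ℝⁿ` with sides parallel to the axes. -/
def IsCube {n : ℕ} (Q : Set (Fin n → ℝ)) : Prop :=
  ∃ (a : Fin n → ℝ) (l : ℝ), 0 < l ∧ Q = Set.Icc a (fun j => a j + l)

/-- The multilinear fractional maximal operator
`𝓜_α(f₁,…,f_m)(x) = sup_{Q ∋ x} ∏ᵢ |Q|^{-(1 - α/(mn))} ∫_Q |fᵢ|`. -/
def fractionalMaximal {n m : ℕ} (α : ℝ) (f : Fin m → (Fin n → ℝ) → ℂ) (x : Fin n → ℝ) : ℝ≥0∞ :=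
  ⨆ (Q : Set (Fin n → ℝ)) (_ : IsCube Q) (_ : x ∈ Q),
    ∏ i, (∫⁻ y in Q, ‖f i y‖ₑ) / volume Q ^ (1 - α / ((m : ℝ) * n))

/-- The Hardy–Littlewood maximal function `M g(x) = sup_{Q ∋ x} |Q|⁻¹ ∫_Q g` of a nonnegative
function, over cubes with sides parallel to the axes. -/
def hardyLittlewoodMaximal {n : ℕ} (g : (Fin n → ℝ) → ℝ≥0∞) (x : Fin n → ℝ) : ℝ≥0∞ :=
  ⨆ (Q : Set (Fin n → ℝ)) (_ : IsCube Q) (_ : x ∈ Q), ⨍⁻ y in Q, g y ∂volume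

/-- The (Fujii–Wilson) constant `[σ]_{A_∞} = sup_Q σ(Q)⁻¹ ∫_Q M(σ χ_Q)`. -/
def aInftyConst {n : ℕ} (σ : (Fin n → ℝ) → ℝ≥0∞) : ℝ≥0∞ :=
  ⨆ (Q : Set (Fin n → ℝ)) (_ : IsCube Q),
    (∫⁻ x in Q, hardyLittlewoodMaximal (Q.indicator σ) x) / ∫⁻ x in Q, σ x

/-- `ν_ω = ∏ᵢ ωᵢ`. -/
def prodWeight {n m : ℕ} (ω : Fin m → (Fin n → ℝ) → ℝ≥0) (x : Fin n → ℝ) : ℝ≥0∞ :=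
  ∏ i, (ω i x : ℝ≥0∞)

/-- `σ = w^{-p'}` where `p' = p / (p - 1)`; it takes the value `∞` where `w` vanishes. -/
def dualWeight {n : ℕ} (p : ℝ) (w : (Fin n → ℝ) → ℝ≥0) (x : Fin n → ℝ) : ℝ≥0∞ :=
  (w x : ℝ≥0∞) ^ (-p.conjExponent)

/-- The constant `[ω]_{A_(P,q)} = sup_Q (|Q|⁻¹ ∫_Q ν_ω^q) ∏ᵢ (|Q|⁻¹ ∫_Q ωᵢ^{-pᵢ'})^{q/pᵢ'}`. -/
def aConst {n m : ℕ} (P : Fin m → ℝ) (q : ℝ) (ω : Fin m → (Fin n → ℝ) → ℝ≥0) : ℝ≥0∞ :=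
  ⨆ (Q : Set (Fin n → ℝ)) (_ : IsCube Q),
    (⨍⁻ x in Q, prodWeight ω x ^ q ∂volume) *
      ∏ i, (⨍⁻ x in Q, dualWeight (P i) (ω i) x ∂volume) ^ (q / (P i).conjExponent)

/-- The class `A_(P,q)` of vectors of nonnegative measurable functions. -/
def MemA {n m : ℕ} (P : Fin m → ℝ) (q : ℝ) (ω : Fin m → (Fin n → ℝ) → ℝ≥0) : Prop :=
  (∀ i, AEMeasurable (ω i) volume) ∧
    (⨆ (Q : Set (Fin n → ℝ)) (_ : IsCube Q),
      (⨍⁻ x in Q, prodWeight ω x ^ q ∂volume) ^ (1 / q) *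
        ∏ i, (⨍⁻ x in Q, dualWeight (P i) (ω i) x ∂volume) ^ (1 / (P i).conjExponent)) < ∞

/-- The measure `w(x)^r dx`, so that `L^r(w^r)` is `L^r` of this measure. -/
def powMeasure {n : ℕ} (w : (Fin n → ℝ) → ℝ≥0∞) (r : ℝ) : Measure (Fin n → ℝ) :=
  volume.withDensity (fun x => w x ^ r)

end MultilinearFractional

end

/-!
By the one-third trick every cube is contained in a comparable cube of one of `2 ^ n` shifted dyadic
grids, so it suffices to bound the maximal operator of a single grid. There the maximal operator is
dominated by a sum over principal cubes, which form a sparse family. The `A_∞` condition turns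
sparseness with respect to Lebesgue measure into a Carleson packing condition for each `σᵢ`, with
constant `2 [σᵢ]_{A_∞}`. Writing `|fᵢ| = gᵢ σᵢ`, the `A_{(P,q)}` condition bounds each term of the
sum by a product of powers of the `σᵢ`-averages of the `gᵢ`; Hölder's inequality for sums separates
the factors, and the Carleson embedding theorem bounds each of them by `∫ gᵢ^{pᵢ} dσᵢ`, which equals
`∫ |fᵢ|^{pᵢ} ωᵢ^{pᵢ}`.
-/

namespace MultilinearFractional

/-! ### Maximal functions over families of sets -/

/-- The maximal function `x ↦ sup {F Q | x ∈ Q ∈ G}` of a set function `F` over a family `G` of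
sets. It covers maximal operators over all cubes and over a dyadic grid alike. -/
noncomputable def maximalOver {X : Type*} (G : Set (Set X)) (F : Set X → ℝ≥0∞) (x : X) : ℝ≥0∞ :=
  ⨆ Q ∈ G, ⨆ _ : x ∈ Q, F Q

section MaximalOver

variable {X : Type*} {G H : Set (Set X)} {F F' : Set X → ℝ≥0∞}

theorem maximalOver_le_iff {x : X} {a : ℝ≥0∞} :
    maximalOver G F x ≤ a ↔ ∀ Q ∈ G, x ∈ Q → F Q ≤ a := by
  simp only [maximalOver, iSup_le_iff]

theorem le_maximalOver {Q : Set X} {x : X} (hQ : Q ∈ G) (hx : x ∈ Q) : F Q ≤ maximalOver G F x :=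
  maximalOver_le_iff.1 le_rfl Q hQ hx

theorem maximalOver_rpow {q : ℝ} (hq : 0 < q) (x : X) :
    maximalOver G F x ^ q = maximalOver G (fun Q => F Q ^ q) x := by
  simp only [maximalOver, ← ENNReal.orderIsoRpow_apply q hq, OrderIso.map_iSup]

theorem maximalOver_le_mul_of_cover {A : ℝ≥0∞}
    (h : ∀ Q ∈ G, ∃ R ∈ H, Q ⊆ R ∧ F Q ≤ A * F' R) (x : X) :
    maximalOver G F x ≤ A * maximalOver H F' x := by
  refine maximalOver_le_iff.2 fun Q hQ hx => ?_
  obtain ⟨R, hR, hQR, hFR⟩ := h Q hQ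
  exact hFR.trans (mul_le_mul_right (le_maximalOver hR (hQR hx)) A)

theorem maximalOver_le_sum_indicator (S : Finset (Set X)) (x : X) :
    maximalOver (S : Set (Set X)) F x ≤ ∑ R ∈ S, R.indicator (fun _ => F R) x := by
  refine maximalOver_le_iff.2 fun Q hQ hx => ?_
  calc F Q = Q.indicator (fun _ => F Q) x := by rw [Set.indicator_of_mem hx]
    _ ≤ _ := Finset.single_le_sum (f := fun R => R.indicator (fun _ => F R) x)
      (fun _ _ => zero_le) hQ

theorem lintegral_maximalOver_le_sum [MeasurableSpace X] {μ : Measure X} {S : Finset (Set X)}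
    (hS : ∀ R ∈ S, MeasurableSet R) :
    ∫⁻ x, maximalOver (S : Set (Set X)) F x ∂μ ≤ ∑ R ∈ S, F R * μ R := by
  calc ∫⁻ x, maximalOver (S : Set (Set X)) F x ∂μ
      ≤ ∫⁻ x, ∑ R ∈ S, R.indicator (fun _ => F R) x ∂μ :=
        lintegral_mono (maximalOver_le_sum_indicator S)
    _ = ∑ R ∈ S, F R * μ R := by
        rw [lintegral_finsetSum _ fun R hR => measurable_const.indicator (hS R hR)]
        exact Finset.sum_congr rfl fun R hR => by
          rw [lintegral_indicator (hS R hR), setLIntegral_const]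

theorem maximalOver_mono (h : G ⊆ H) : maximalOver G F ≤ maximalOver H F := fun _ =>
  maximalOver_le_iff.2 fun _ hQ hx => le_maximalOver (h hQ) hx

theorem measurable_maximalOver [MeasurableSpace X] (hG : G.Countable)
    (hmeas : ∀ Q ∈ G, MeasurableSet Q) : Measurable (maximalOver G F) := by
  have h (Q : Set X) : (fun x => ⨆ _ : x ∈ Q, F Q) = Q.indicator fun _ => F Q := by
    ext x
    by_cases hx : x ∈ Q <;> simp [hx]
  refine Measurable.biSup G hG fun Q hQ => ?_
  rw [h]
  exact measurable_const.indicator (hmeas Q hQ)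

theorem lintegral_maximalOver_le_of_finite [MeasurableSpace X] {μ : Measure X} (hG : G.Countable)
    (hmeas : ∀ Q ∈ G, MeasurableSet Q) {B : ℝ≥0∞}
    (hB : ∀ S ⊆ G, S.Finite → ∫⁻ x, maximalOver S F x ∂μ ≤ B) :
    ∫⁻ x, maximalOver G F x ∂μ ≤ B := by
  have := hG.to_subtype
  let S (T : Finset G) : Set (Set X) := Subtype.val '' (T : Set G)
  have hSG (T : Finset G) : S T ⊆ G := by simp [S]
  have hSfin (T : Finset G) : (S T).Finite := T.finite_toSet.image _
  have hmono : Monotone fun T => maximalOver (S T) F := fun T U hTU =>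
    maximalOver_mono (Set.image_mono (Finset.coe_subset.2 hTU))
  have hsup (x : X) : maximalOver G F x = ⨆ T, maximalOver (S T) F x := by
    refine le_antisymm (maximalOver_le_iff.2 fun Q hQ hx => ?_)
      (iSup_le fun T => maximalOver_mono (hSG T) x)
    exact le_iSup_of_le {⟨Q, hQ⟩} (le_maximalOver (by simp [S]) hx)
  simp_rw [hsup]
  rw [lintegral_iSup_directed (fun T => (measurable_maximalOver (hSfin T).countable
    fun Q hQ => hmeas Q (hSG T hQ)).aemeasurable) hmono.directed_le]
  exact iSup_le fun T => hB (S T) (hSG T) (hSfin T)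

theorem maximalOver_iUnion_le_sum {β : Type*} [Fintype β] (G : β → Set (Set X)) (x : X) :
    maximalOver (⋃ b, G b) F x ≤ ∑ b, maximalOver (G b) F x := by
  refine maximalOver_le_iff.2 fun Q hQ hx => ?_
  obtain ⟨b, hb⟩ := Set.mem_iUnion.1 hQ
  exact (le_maximalOver hb hx).trans
    (Finset.single_le_sum (f := fun b => maximalOver (G b) F x) (fun _ _ => zero_le)
      (Finset.mem_univ b))

end MaximalOver

/-! ### Laminar families and the Carleson embedding theorem -/

/-- A family of sets, any two of which are nested or disjoint. -/
def Laminar {X : Type*} (G : Set (Set X)) : Prop :=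
  ∀ Q ∈ G, ∀ R ∈ G, Q ⊆ R ∨ R ⊆ Q ∨ Disjoint Q R

open scoped Classical in
/-- The Carleson packing condition with constant `Λ`: the members of `S` inside a given member `R`
have total measure at most `Λ μ(R)`. -/
def IsCarleson {X : Type*} [MeasurableSpace X] (μ : Measure X) (Λ : ℝ≥0∞)
    (S : Finset (Set X)) : Prop :=
  ∀ R ∈ S, ∑ Q ∈ S with Q ⊆ R, μ Q ≤ Λ * μ R

/-- The constant `2^p p'` of the Carleson embedding theorem. -/
noncomputable def carlesonConst (p : ℝ) : ℝ≥0∞ :=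
  2 ^ p * ENNReal.ofReal p.conjExponent

theorem carlesonConst_ne_top {p : ℝ} (hp : 0 ≤ p) : carlesonConst p ≠ ∞ :=
  ENNReal.mul_ne_top (ENNReal.rpow_ne_top_of_nonneg hp ENNReal.ofNat_ne_top) ENNReal.ofReal_ne_top

theorem Laminar.mono {X : Type*} {G H : Set (Set X)} (hG : Laminar G) (h : H ⊆ G) : Laminar H :=
  fun Q hQ R hR => hG Q (h hQ) R (h hR)

theorem Laminar.exists_disjoint_cover {X : Type*} {S : Finset (Set X)}
    (hS : Laminar (S : Set (Set X))) :
    ∃ H ⊆ S, (H : Set (Set X)).PairwiseDisjoint id ∧ ∀ Q ∈ S, ∃ R ∈ H, Q ⊆ R := by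
  classical
  refine ⟨S.filter (Maximal (· ∈ S)), Finset.filter_subset _ _, fun Q hQ R hR hne => ?_,
    fun Q hQ => ?_⟩
  · obtain ⟨hQS, hQmax⟩ := Finset.mem_filter.1 hQ
    obtain ⟨hRS, hRmax⟩ := Finset.mem_filter.1 hR
    rcases hS Q hQS R hRS with h | h | h
    · exact absurd (hQmax.eq_of_le hRS h) hne
    · exact absurd (hRmax.eq_of_le hQS h).symm hne
    · exact h
  · obtain ⟨R, hQR, hR⟩ := S.exists_le_maximal hQ
    exact ⟨R, Finset.mem_filter.2 ⟨hR.1, hR⟩, hQR⟩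

section Carleson

variable {X : Type*} [MeasurableSpace X] {μ : Measure X} {S T : Finset (Set X)} {Λ : ℝ≥0∞}

theorem IsCarleson.mono (hS : IsCarleson μ Λ S) (h : T ⊆ S) : IsCarleson μ Λ T := by
  classical
  exact fun R hR => (Finset.sum_le_sum_of_subset (Finset.filter_subset_filter _ h)).trans
    (hS R (h hR))

open scoped Classical in
theorem IsCarleson.exists_sum_le (hS : IsCarleson μ Λ S) (hlam : Laminar (S : Set (Set X))) :
    ∃ H ⊆ S, (H : Set (Set X)).PairwiseDisjoint id ∧ ∑ Q ∈ S, μ Q ≤ Λ * ∑ R ∈ H, μ R := by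
  obtain ⟨H, hHS, hdisj, hcov⟩ := hlam.exists_disjoint_cover
  refine ⟨H, hHS, hdisj, ?_⟩
  calc ∑ Q ∈ S, μ Q ≤ ∑ Q ∈ S, ∑ R ∈ H with Q ⊆ R, μ Q := by
        refine Finset.sum_le_sum fun Q hQ => ?_
        obtain ⟨R, hR, hQR⟩ := hcov Q hQ
        exact Finset.single_le_sum (f := fun _ => μ Q) (fun _ _ => zero_le)
          (Finset.mem_filter.2 ⟨hR, hQR⟩)
    _ = ∑ R ∈ H, ∑ Q ∈ S with Q ⊆ R, μ Q := Finset.sum_comm' (by simp; tauto)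
    _ ≤ ∑ R ∈ H, Λ * μ R := Finset.sum_le_sum fun R hR => hS R (hHS hR)
    _ = Λ * ∑ R ∈ H, μ R := (Finset.mul_sum _ _ _).symm

theorem mul_measure_le_of_le_setLAverage {g : X → ℝ≥0∞} {Q : Set X} {t : ℝ≥0∞} (ht : t ≠ ∞)
    (h : t ≤ ⨍⁻ x in Q, g x ∂μ) :
    t * μ Q ≤ 2 * ∫⁻ x in Q, (if t < 2 * g x then g x else 0) ∂μ := by
  rw [setLAverage_eq] at h
  rcases eq_or_ne (μ Q) ∞ with hQ | hQ
  · simp_all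
  set I := ∫⁻ x in Q, (if t < 2 * g x then g x else 0) ∂μ
  have hpt (x : X) : 2 * g x ≤ t + 2 * (if t < 2 * g x then g x else 0) := by
    split_ifs with hx
    · exact le_add_self
    · simpa using hx
  have hsum : t * μ Q + t * μ Q ≤ t * μ Q + 2 * I := by
    calc t * μ Q + t * μ Q = 2 * (t * μ Q) := (two_mul _).symm
      _ ≤ 2 * ∫⁻ x in Q, g x ∂μ := by gcongr; exact ENNReal.mul_le_of_le_div h
      _ = ∫⁻ x in Q, 2 * g x ∂μ := (lintegral_const_mul' _ _ ENNReal.ofNat_ne_top).symm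
      _ ≤ ∫⁻ x in Q, (t + 2 * (if t < 2 * g x then g x else 0)) ∂μ := lintegral_mono hpt
      _ = t * μ Q + 2 * I := by
        rw [lintegral_add_left measurable_const, setLIntegral_const,
          lintegral_const_mul' _ _ ENNReal.ofNat_ne_top]
  exact (ENNReal.add_le_add_iff_left (ENNReal.mul_ne_top ht hQ)).1 hsum

open scoped Classical in
theorem IsCarleson.mul_sum_measure_le (hS : IsCarleson μ Λ S) (hlam : Laminar (S : Set (Set X)))
    (hmeas : ∀ Q ∈ S, MeasurableSet Q) (g : X → ℝ≥0∞) {t : ℝ≥0∞} (ht : t ≠ ∞) :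
    t * ∑ Q ∈ S with t < ⨍⁻ x in Q, g x ∂μ, μ Q ≤
      Λ * (2 * ∫⁻ x, (if t < 2 * g x then g x else 0) ∂μ) := by
  have hsub : (S.filter fun Q => t < ⨍⁻ x in Q, g x ∂μ) ⊆ S := Finset.filter_subset _ _
  obtain ⟨H, hH, hdisj, hle⟩ :=
    (hS.mono hsub).exists_sum_le (hlam.mono (Finset.coe_subset.2 hsub))
  calc t * ∑ Q ∈ S with t < ⨍⁻ x in Q, g x ∂μ, μ Q
      ≤ t * (Λ * ∑ R ∈ H, μ R) := by gcongr
    _ = Λ * ∑ R ∈ H, t * μ R := by rw [mul_left_comm, Finset.mul_sum]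
    _ ≤ Λ * ∑ R ∈ H, 2 * ∫⁻ x in R, (if t < 2 * g x then g x else 0) ∂μ := by
        gcongr Λ * ∑ R ∈ H, ?_ with R hR
        exact mul_measure_le_of_le_setLAverage ht (Finset.mem_filter.1 (hH hR)).2.le
    _ = Λ * (2 * ∫⁻ x in ⋃ R ∈ H, id R, (if t < 2 * g x then g x else 0) ∂μ) := by
        rw [← Finset.mul_sum, lintegral_biUnion_finset (t := id) hdisj
          fun R hR => hmeas R (hsub (hH hR))]
        simp only [id]
    _ ≤ _ := by
        gcongr
        exact Measure.restrict_le_self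

theorem coe_rpow_eq_lintegral {p : ℝ} (hp : 0 < p) (a : ℝ≥0) :
    (a : ℝ≥0∞) ^ p = ENNReal.ofReal p * ∫⁻ t in Set.Ioi (0 : ℝ),
      (if ENNReal.ofReal t < a then ENNReal.ofReal (t ^ (p - 1)) else 0) := by
  have h := lintegral_rpow_eq_lintegral_meas_lt_mul (Measure.dirac ()) (f := fun _ => (a : ℝ))
    (Filter.Eventually.of_forall fun _ => a.coe_nonneg) aemeasurable_const hp
  simp only [lintegral_const, measure_univ, mul_one] at h
  have ha : (a : ℝ≥0∞) ^ p = ENNReal.ofReal ((a : ℝ) ^ p) := by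
    rw [← ENNReal.ofReal_rpow_of_nonneg a.coe_nonneg hp.le, ENNReal.ofReal_coe_nnreal]
  rw [ha, h]
  congr 1
  refine setLIntegral_congr_fun measurableSet_Ioi fun t ht => ?_
  have ht : 0 < t := ht
  by_cases hta : t < a <;> simp [hta, ENNReal.ofReal_lt_coe_iff ht.le]

theorem rpow_eq_lintegral {p : ℝ} (hp : 0 < p) (a : ℝ≥0∞) :
    a ^ p = ENNReal.ofReal p * ∫⁻ t in Set.Ioi (0 : ℝ),
      (if ENNReal.ofReal t < a then ENNReal.ofReal (t ^ (p - 1)) else 0) := by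
  induction a with
  | coe a => exact coe_rpow_eq_lintegral hp a
  | top =>
    rw [ENNReal.top_rpow_of_pos hp, eq_comm]
    refine ENNReal.eq_top_of_forall_nnreal_le fun r => ?_
    calc (r : ℝ≥0∞) = ((r ^ p⁻¹ : ℝ≥0) : ℝ≥0∞) ^ p := by
          rw [← ENNReal.coe_rpow_of_nonneg _ hp.le, NNReal.rpow_inv_rpow hp.ne']
      _ ≤ _ := by
          rw [coe_rpow_eq_lintegral hp]
          gcongr with t
          split_ifs <;> simp_all

theorem sum_mul_rpow_eq_lintegral {κ : Type*} {p : ℝ} (hp : 0 < p) (s : Finset κ)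
    (h a : κ → ℝ≥0∞) :
    ∑ k ∈ s, h k * a k ^ p = ENNReal.ofReal p * ∫⁻ t in Set.Ioi (0 : ℝ),
      (∑ k ∈ s with ENNReal.ofReal t < a k, h k) * ENNReal.ofReal (t ^ (p - 1)) := by
  have hmeas (k : κ) : Measurable fun t : ℝ =>
      if ENNReal.ofReal t < a k then ENNReal.ofReal (t ^ (p - 1)) else 0 :=
    Measurable.ite (measurableSet_lt (by fun_prop) measurable_const) (by fun_prop) measurable_const
  simp_rw [Finset.sum_filter, Finset.sum_mul, ite_mul, zero_mul, rpow_eq_lintegral hp,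
    mul_left_comm (h _), ← Finset.mul_sum, ← lintegral_const_mul _ (hmeas _)]
  rw [← lintegral_finsetSum _ fun k _ => (hmeas k).const_mul _]
  simp_rw [mul_ite, mul_zero]

theorem lintegral_mul_rpow_eq_lintegral [SFinite μ] {p : ℝ} (hp : 0 < p) {h a : X → ℝ≥0∞}
    (hh : AEMeasurable h μ) (ha : AEMeasurable a μ) :
    ∫⁻ x, h x * a x ^ p ∂μ = ENNReal.ofReal p * ∫⁻ t in Set.Ioi (0 : ℝ),
      (∫⁻ x, (if ENNReal.ofReal t < a x then h x else 0) ∂μ) * ENNReal.ofReal (t ^ (p - 1)) := by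
  let φ (x : X) (t : ℝ) : ℝ≥0∞ :=
    (if ENNReal.ofReal t < a x then h x else 0) * ENNReal.ofReal (t ^ (p - 1))
  have hφ : AEMeasurable (Function.uncurry φ) (μ.prod (volume.restrict (Set.Ioi 0))) := by
    have hset := nullMeasurableSet_lt (μ := μ.prod (volume.restrict (Set.Ioi 0)))
      measurable_snd.ennreal_ofReal.aemeasurable ha.comp_fst
    refine ((hh.comp_fst.indicator₀ hset).mul
      (measurable_snd.pow_const (p - 1)).ennreal_ofReal.aemeasurable).congr (.of_forall fun z => ?_)
    simp only [φ, Function.uncurry, Pi.mul_apply, Set.indicator_apply, Set.mem_ofPred_eq]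
  have hpt (x : X) : h x * a x ^ p = ENNReal.ofReal p * ∫⁻ t in Set.Ioi (0 : ℝ), φ x t := by
    rw [rpow_eq_lintegral hp, mul_left_comm, ← lintegral_const_mul]
    · simp only [φ, mul_ite, mul_zero, ite_mul, zero_mul]
    · exact Measurable.ite (measurableSet_lt (by fun_prop) measurable_const) (by fun_prop)
        measurable_const
  simp_rw [hpt]
  rw [lintegral_const_mul' _ _ ENNReal.ofReal_ne_top, lintegral_lintegral_swap hφ]
  congr 1
  exact lintegral_congr fun t => lintegral_mul_const' _ _ ENNReal.ofReal_ne_top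

theorem mul_lintegral_levelSet_eq [SFinite μ] {g : X → ℝ≥0∞} (hg : AEMeasurable g μ) {p : ℝ}
    (hp : 1 < p) :
    ENNReal.ofReal p * (2 * ∫⁻ t in Set.Ioi (0 : ℝ),
      (∫⁻ x, (if ENNReal.ofReal t < 2 * g x then g x else 0) ∂μ) *
        ENNReal.ofReal (t ^ (p - 1 - 1))) = carlesonConst p * ∫⁻ x, g x ^ p ∂μ := by
  set J := ∫⁻ t in Set.Ioi (0 : ℝ), (∫⁻ x, (if ENNReal.ofReal t < 2 * g x then g x else 0) ∂μ) *
    ENNReal.ofReal (t ^ (p - 1 - 1)) with hJ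
  have hp1 : 0 < p - 1 := by linarith
  have hpt (x : X) : 2 * (g x * (2 * g x) ^ (p - 1)) = 2 ^ p * g x ^ p := by
    have hpow (a : ℝ≥0∞) : a * a ^ (p - 1) = a ^ p := by
      simpa using (ENNReal.rpow_add_of_nonneg (x := a) 1 (p - 1) zero_le_one hp1.le).symm
    rw [← mul_assoc, hpow, ENNReal.mul_rpow_of_nonneg _ _ (by linarith)]
  have hpJ : 2 ^ p * ∫⁻ x, g x ^ p ∂μ = ENNReal.ofReal (p - 1) * (2 * J) := by
    rw [← lintegral_const_mul' _ _ (by finiteness), mul_left_comm, hJ,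
      ← lintegral_mul_rpow_eq_lintegral hp1 hg (hg.const_mul 2),
      ← lintegral_const_mul' _ _ ENNReal.ofNat_ne_top]
    simp_rw [hpt]
  have hconj : ENNReal.ofReal p.conjExponent * ENNReal.ofReal (p - 1) = ENNReal.ofReal p := by
    rw [← ENNReal.ofReal_mul (Real.HolderConjugate.conjExponent hp).symm.nonneg,
      Real.conjExponent, div_mul_cancel₀ _ hp1.ne']
  rw [carlesonConst, mul_comm (2 ^ p), mul_assoc, hpJ, ← mul_assoc _ _ (2 * J), hconj]

theorem IsCarleson.sum_setLAverage_rpow_mul_le [SFinite μ] (hS : IsCarleson μ Λ S)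
    (hlam : Laminar (S : Set (Set X))) (hmeas : ∀ Q ∈ S, MeasurableSet Q) {g : X → ℝ≥0∞}
    (hg : AEMeasurable g μ) {p : ℝ} (hp : 1 < p) :
    ∑ Q ∈ S, (⨍⁻ x in Q, g x ∂μ) ^ p * μ Q ≤ carlesonConst p * Λ * ∫⁻ x, g x ^ p ∂μ := by
  classical
  let I (t : ℝ) : ℝ≥0∞ := ∫⁻ x, (if ENNReal.ofReal t < 2 * g x then g x else 0) ∂μ
  have hI : Antitone I := fun t u htu => lintegral_mono fun x => by
    split_ifs with hu ht
    · exact le_rfl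
    · exact absurd ((ENNReal.ofReal_le_ofReal htu).trans_lt hu) ht
    · exact zero_le
    · exact le_rfl
  have hlevel (t : ℝ) (ht : 0 < t) :
      (∑ Q ∈ S with ENNReal.ofReal t < ⨍⁻ x in Q, g x ∂μ, μ Q) * ENNReal.ofReal (t ^ (p - 1)) ≤
        (Λ * 2) * (I t * ENNReal.ofReal (t ^ (p - 1 - 1))) := by
    have hpow : ENNReal.ofReal (t ^ (p - 1)) =
        ENNReal.ofReal t * ENNReal.ofReal (t ^ (p - 1 - 1)) := by
      rw [← ENNReal.ofReal_mul ht.le, Real.rpow_sub_one ht.ne' (p - 1), mul_div_cancel₀ _ ht.ne']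
    rw [hpow, ← mul_assoc, ← mul_assoc, mul_comm (∑ Q ∈ _, _), mul_assoc Λ]
    exact mul_le_mul_left (hS.mul_sum_measure_le hlam hmeas g ENNReal.ofReal_ne_top) _
  calc ∑ Q ∈ S, (⨍⁻ x in Q, g x ∂μ) ^ p * μ Q
      = ENNReal.ofReal p * ∫⁻ t in Set.Ioi (0 : ℝ),
          (∑ Q ∈ S with ENNReal.ofReal t < ⨍⁻ x in Q, g x ∂μ, μ Q) *
            ENNReal.ofReal (t ^ (p - 1)) := by
        simp_rw [mul_comm (_ ^ p)]
        exact sum_mul_rpow_eq_lintegral (by linarith) S _ _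
    _ ≤ ENNReal.ofReal p * ∫⁻ t in Set.Ioi (0 : ℝ),
          (Λ * 2) * (I t * ENNReal.ofReal (t ^ (p - 1 - 1))) := by
        gcongr ENNReal.ofReal p * ?_
        exact setLIntegral_mono' measurableSet_Ioi hlevel
    _ = carlesonConst p * Λ * ∫⁻ x, g x ^ p ∂μ := by
        have hmeasI : Measurable fun t => I t * ENNReal.ofReal (t ^ (p - 1 - 1)) :=
          hI.measurable.mul (by fun_prop)
        rw [lintegral_const_mul _ hmeasI, mul_assoc Λ, mul_left_comm,
          mul_lintegral_levelSet_eq hg hp]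
        ring

end Carleson

/-! ### Sparse families and principal sets -/

/-- The part of `R` covered by the members of `S` strictly inside `R`. -/
def descendants {X : Type*} (S : Finset (Set X)) (R : Set X) : Set X :=
  ⋃ T ∈ S, ⋃ _ : T ⊂ R, T

/-- Sparseness with constant one half: the members of `S` strictly inside a given member `R`
cover at most half of it. -/
def IsSparse {X : Type*} [MeasurableSpace X] (μ : Measure X) (S : Finset (Set X)) : Prop :=
  ∀ R ∈ S, 2 * μ (descendants S R) ≤ μ R

/-- The Fujii–Wilson `A_∞` condition of `σ` with respect to `μ` and the family `G`, with constant
`L`; only averages over members of `G` enter the localized maximal function. -/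
def HasAInftyBound {X : Type*} [MeasurableSpace X] (G : Set (Set X)) (μ σ : Measure X)
    (L : ℝ≥0∞) : Prop :=
  ∀ R ∈ G, ∫⁻ x in R, maximalOver {Q ∈ G | Q ⊆ R} (fun Q => σ Q / μ Q) x ∂μ ≤ L * σ R

/-- The fractional mean `∏ᵢ κᵢ(Q) / μ(Q)^s` of a vector of measures. -/
noncomputable def fracMean {ι X : Type*} [Fintype ι] [MeasurableSpace X] (s : ℝ) (μ : Measure X)
    (κ : ι → Measure X) (Q : Set X) : ℝ≥0∞ :=
  (∏ i, κ i Q) / μ Q ^ s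

section Sparse

variable {X : Type*} {S : Finset (Set X)}

theorem subset_descendants {T R : Set X} (hT : T ∈ S) (hTR : T ⊂ R) : T ⊆ descendants S R :=
  Set.subset_iUnion₂_of_subset T hT (Set.subset_iUnion_of_subset hTR subset_rfl)

theorem Laminar.pairwiseDisjoint_sdiff_descendants (hS : Laminar (S : Set (Set X))) :
    (S : Set (Set X)).PairwiseDisjoint fun Q => Q \ descendants S Q := by
  have hnested {A B : Set X} (hA : A ∈ S) (hAB : A ⊂ B) :
      Disjoint (A \ descendants S A) (B \ descendants S B) :=
    Set.disjoint_left.2 fun x hx hx' => hx'.2 (subset_descendants hA hAB hx.1)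
  intro Q hQ T hT hne
  rcases hS Q hQ T hT with h | h | h
  · exact hnested hQ (h.ssubset_of_ne hne)
  · exact (hnested hT (h.ssubset_of_ne hne.symm)).symm
  · exact h.mono Set.sdiff_subset Set.sdiff_subset

theorem exists_principal (F : Set X → ℝ≥0∞) {A : ℝ≥0∞} (hA : 1 ≤ A) (G : Finset (Set X)) :
    ∃ S ⊆ G, (∀ Q ∈ G, ∃ R ∈ S, Q ⊆ R ∧ F Q ≤ A * F R) ∧
      ∀ T ∈ S, ∀ R ∈ S, T ⊂ R → A * F R < F T := by
  classical
  induction G using Finset.strongInduction with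
  | H G ih =>
    rcases G.eq_empty_or_nonempty with rfl | hne
    · exact ⟨∅, by simp⟩
    -- A minimal member `Q₀` lies above no other one, so it can be added last.
    obtain ⟨Q₀, hQ₀, hmin⟩ := G.exists_minimal hne
    obtain ⟨S, hSG, hcov, hS⟩ := ih (G.erase Q₀) (Finset.erase_ssubset hQ₀)
    have hSG' : S ⊆ G := hSG.trans (Finset.erase_subset _ _)
    have hcov_insert {S' : Finset (Set X)} (hSS' : S ⊆ S')
        (hQ₀' : ∃ R ∈ S', Q₀ ⊆ R ∧ F Q₀ ≤ A * F R) :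
        ∀ Q ∈ G, ∃ R ∈ S', Q ⊆ R ∧ F Q ≤ A * F R := fun Q hQ => by
      by_cases hQQ : Q = Q₀
      · rwa [hQQ]
      · obtain ⟨R, hR, h⟩ := hcov Q (Finset.mem_erase.2 ⟨hQQ, hQ⟩)
        exact ⟨R, hSS' hR, h⟩
    by_cases h : ∃ R ∈ S, Q₀ ⊆ R ∧ F Q₀ ≤ A * F R
    · exact ⟨S, hSG', hcov_insert subset_rfl h, hS⟩
    push Not at h
    have hins : insert Q₀ S ⊆ G := Finset.insert_subset hQ₀ hSG'
    refine ⟨insert Q₀ S, hins, hcov_insert (Finset.subset_insert _ _)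
      ⟨Q₀, Finset.mem_insert_self _ _, subset_rfl, le_mul_of_one_le_left' hA⟩, ?_⟩
    intro T hT R hR hTR
    rcases Finset.mem_insert.1 hR with rfl | hRS
    · exact absurd (hmin (hins hT) hTR.le) hTR.not_ge
    rcases Finset.mem_insert.1 hT with rfl | hTS
    · exact h R hRS hTR.le
    · exact hS T hTS R hRS hTR

variable [MeasurableSpace X] {μ σ : Measure X} {L : ℝ≥0∞}

theorem HasAInftyBound.mono {G H : Set (Set X)} (hG : HasAInftyBound G μ σ L) (h : H ⊆ G) :
    HasAInftyBound H μ σ L := fun R hR => by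
  have hsub : {Q ∈ H | Q ⊆ R} ⊆ {Q ∈ G | Q ⊆ R} := fun Q hQ => ⟨h hQ.1, hQ.2⟩
  exact (lintegral_mono (maximalOver_mono hsub)).trans (hG R (h hR))

theorem IsSparse.measure_le (hS : IsSparse μ S) {Q : Set X} (hQ : Q ∈ S) (htop : μ Q ≠ ∞) :
    μ Q ≤ 2 * μ (Q \ descendants S Q) := by
  have h : μ Q + μ Q ≤ μ Q + 2 * μ (Q \ descendants S Q) := by
    calc μ Q + μ Q = 2 * μ Q := (two_mul _).symm
      _ ≤ 2 * (μ (descendants S Q) + μ (Q \ descendants S Q)) := by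
        gcongr
        exact (measure_mono (by simp)).trans (measure_union_le _ _)
      _ = 2 * μ (descendants S Q) + 2 * μ (Q \ descendants S Q) := mul_add _ _ _
      _ ≤ μ Q + 2 * μ (Q \ descendants S Q) := by gcongr; exact hS Q hQ
  exact (ENNReal.add_le_add_iff_left htop).1 h

theorem measurableSet_descendants (hmeas : ∀ Q ∈ S, MeasurableSet Q) (R : Set X) :
    MeasurableSet (descendants S R) :=
  Finset.measurableSet_biUnion _ fun T hT => MeasurableSet.iUnion fun _ => hmeas T hT

theorem IsSparse.isCarleson (hS : IsSparse μ S) (hlam : Laminar (S : Set (Set X)))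
    (hmeas : ∀ Q ∈ S, MeasurableSet Q) (h0 : ∀ Q ∈ S, μ Q ≠ 0) (htop : ∀ Q ∈ S, μ Q ≠ ∞)
    (hσ : HasAInftyBound (S : Set (Set X)) μ σ L) : IsCarleson σ (2 * L) S := by
  classical
  intro R hR
  set M := maximalOver {Q ∈ (S : Set (Set X)) | Q ⊆ R} fun Q => σ Q / μ Q
  have hdiff {Q : Set X} (hQ : Q ∈ S) : MeasurableSet (Q \ descendants S Q) :=
    (hmeas Q hQ).diff (measurableSet_descendants hmeas Q)
  calc ∑ Q ∈ S with Q ⊆ R, σ Q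
      ≤ ∑ Q ∈ S with Q ⊆ R, 2 * ∫⁻ x in Q \ descendants S Q, M x ∂μ := by
        refine Finset.sum_le_sum fun Q hQ => ?_
        obtain ⟨hQ, hQR⟩ := Finset.mem_filter.1 hQ
        calc σ Q = σ Q / μ Q * μ Q := (ENNReal.div_mul_cancel (h0 Q hQ) (htop Q hQ)).symm
          _ ≤ σ Q / μ Q * (2 * μ (Q \ descendants S Q)) := by
            gcongr
            exact hS.measure_le hQ (htop Q hQ)
          _ = 2 * ∫⁻ _ in Q \ descendants S Q, σ Q / μ Q ∂μ := by
            rw [setLIntegral_const, mul_left_comm]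
          _ ≤ 2 * ∫⁻ x in Q \ descendants S Q, M x ∂μ := by
            gcongr 2 * ?_
            exact setLIntegral_mono' (hdiff hQ) fun _ hx => le_maximalOver ⟨hQ, hQR⟩ hx.1
    _ = 2 * ∫⁻ x in ⋃ Q ∈ S.filter (· ⊆ R), Q \ descendants S Q, M x ∂μ := by
        rw [lintegral_biUnion_finset (hlam.pairwiseDisjoint_sdiff_descendants.subset
          (Finset.coe_subset.2 (Finset.filter_subset _ _)))
          fun Q hQ => hdiff (Finset.mem_filter.1 hQ).1, Finset.mul_sum]
    _ ≤ 2 * ∫⁻ x in R, M x ∂μ := by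
        gcongr
        exact Set.iUnion₂_subset fun Q hQ => Set.sdiff_subset.trans (Finset.mem_filter.1 hQ).2
    _ ≤ 2 * L * σ R := by
        rw [mul_assoc]
        gcongr
        exact hσ R hR

end Sparse

section Hoelder

variable {ι κ : Type*} [Fintype ι]

theorem sum_rpow_le_rpow_sum (s : Finset κ) (f : κ → ℝ≥0∞) {r : ℝ} (hr : 1 ≤ r) :
    ∑ k ∈ s, f k ^ r ≤ (∑ k ∈ s, f k) ^ r := by
  classical
  induction s using Finset.induction_on with
  | empty => simp
  | insert a s ha ih =>
    rw [Finset.sum_insert ha, Finset.sum_insert ha]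
    exact (add_le_add_right ih _).trans (ENNReal.add_rpow_le_rpow_add _ _ hr)

theorem sum_prod_rpow_le_of_sum_eq_one (s : Finset κ) (f : ι → κ → ℝ≥0∞) {e : ι → ℝ}
    (he0 : ∀ i, 0 ≤ e i) (he : ∑ i, e i = 1) :
    ∑ k ∈ s, ∏ i, f i k ^ e i ≤ ∏ i, (∑ k ∈ s, f i k) ^ e i := by
  let _ : MeasurableSpace s := ⊤
  have h := ENNReal.lintegral_prod_norm_pow_le (μ := (Measure.count : Measure s)) Finset.univ
    (f := fun i k => f i k) (fun i _ => measurable_from_top.aemeasurable) he fun i _ => he0 i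
  simp only [lintegral_count, tsum_fintype, Finset.univ_eq_attach] at h
  rw [Finset.sum_attach s fun k => ∏ i, f i k ^ e i] at h
  refine h.trans_eq (Finset.prod_congr rfl fun i _ => ?_)
  rw [Finset.sum_attach s fun k => f i k]

theorem sum_prod_rpow_le (s : Finset κ) (f : ι → κ → ℝ≥0∞) {e : ι → ℝ} (he0 : ∀ i, 0 ≤ e i)
    (he : 1 ≤ ∑ i, e i) :
    ∑ k ∈ s, ∏ i, f i k ^ e i ≤ ∏ i, (∑ k ∈ s, f i k) ^ e i := by
  set r := ∑ i, e i
  have hr : 0 < r := by linarith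
  have hprod (x : ι → ℝ≥0∞) : ∏ i, x i ^ e i = (∏ i, x i ^ (e i / r)) ^ r := by
    simp_rw [← ENNReal.prod_rpow_of_nonneg hr.le, ← ENNReal.rpow_mul, div_mul_cancel₀ _ hr.ne']
  calc ∑ k ∈ s, ∏ i, f i k ^ e i = ∑ k ∈ s, (∏ i, f i k ^ (e i / r)) ^ r := by simp_rw [hprod]
    _ ≤ (∑ k ∈ s, ∏ i, f i k ^ (e i / r)) ^ r := sum_rpow_le_rpow_sum s _ he
    _ ≤ (∏ i, (∑ k ∈ s, f i k) ^ (e i / r)) ^ r := by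
        gcongr
        refine sum_prod_rpow_le_of_sum_eq_one s f (fun i => div_nonneg (he0 i) hr.le) ?_
        rw [← Finset.sum_div, div_self hr.ne']
    _ = ∏ i, (∑ k ∈ s, f i k) ^ e i := (hprod _).symm

end Hoelder

/-! ### The two-weight inequality for laminar families -/

section TwoWeight

variable {ι X : Type*} [Fintype ι] [MeasurableSpace X] {S : Finset (Set X)} {μ ν : Measure X}
  {s q : ℝ}

theorem mul_div_rpow_le_div {a b c k l : ℝ≥0∞} {r : ℝ} (hs : 0 ≤ s) (hsr : s ≤ r) (hab : a ≤ b)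
    (hkl : k ≤ l) (hl : l ≠ ∞) (h : c * (l / b ^ s) < k / a ^ s) :
    c * (a / b) ^ r ≤ k / l := by
  have hl0 : l ≠ 0 := by
    rintro rfl
    simp [nonpos_iff_eq_zero.1 hkl] at h
  have hab' : a / b ≤ 1 := ENNReal.div_le_of_le_mul (by rwa [one_mul])
  calc c * (a / b) ^ r ≤ c * (a ^ s / b ^ s) := by
        rw [← ENNReal.div_rpow_of_nonneg _ _ hs]
        gcongr c * ?_
        exact ENNReal.rpow_le_rpow_of_exponent_ge hab' hsr
    _ ≤ k / l := by
        rw [ENNReal.le_div_iff_mul_le (.inl hl0) (.inl hl)]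
        calc c * (a ^ s / b ^ s) * l = c * (l / b ^ s) * a ^ s := by
              simp only [div_eq_mul_inv]
              ring
          _ ≤ k := ENNReal.mul_le_of_le_div h.le

theorem two_mul_measure_le_of_fracMean_lt [Nonempty ι] {κ : ι → Measure X} {T R : Set X}
    (hs : 0 ≤ s) (hs' : s ≤ Fintype.card ι) (hTR : T ⊆ R) (hR0 : μ R ≠ 0) (hR : μ R ≠ ∞)
    (hκ : ∀ i, κ i R ≠ ∞)
    (h : 2 ^ Fintype.card ι * fracMean s μ κ R < fracMean s μ κ T) :
    2 * μ T ≤ μ R * ((∏ i, κ i T) ^ (Fintype.card ι : ℝ)⁻¹ /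
      (∏ i, κ i R) ^ (Fintype.card ι : ℝ)⁻¹) := by
  have hm : (0 : ℝ) < Fintype.card ι := by exact_mod_cast Fintype.card_pos
  have hpow : (2 * (μ T / μ R)) ^ (Fintype.card ι : ℝ) ≤ (∏ i, κ i T) / ∏ i, κ i R := by
    rw [ENNReal.mul_rpow_of_nonneg _ _ hm.le, ENNReal.rpow_natCast 2]
    exact mul_div_rpow_le_div hs hs' (measure_mono hTR)
      (Finset.prod_le_prod' fun i _ => measure_mono hTR) (ENNReal.prod_ne_top fun i _ => hκ i) h
  calc 2 * μ T = μ R * (2 * (μ T / μ R)) := by rw [mul_left_comm, ENNReal.mul_div_cancel hR0 hR]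
    _ ≤ _ := by
        rw [← ENNReal.div_rpow_of_nonneg _ _ (inv_nonneg.2 hm.le)]
        gcongr
        exact (ENNReal.le_rpow_inv_iff hm).2 hpow

theorem sum_prod_measure_rpow_le [Nonempty ι] {κ : ι → Measure X} {R : Set X}
    (hmeas : ∀ T ∈ S, MeasurableSet T) (hdisj : (S : Set (Set X)).PairwiseDisjoint id)
    (hR : ∀ T ∈ S, T ⊆ R) :
    ∑ T ∈ S, (∏ i, κ i T) ^ (Fintype.card ι : ℝ)⁻¹ ≤ (∏ i, κ i R) ^ (Fintype.card ι : ℝ)⁻¹ := by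
  have hm : (0 : ℝ) < Fintype.card ι := by exact_mod_cast Fintype.card_pos
  simp_rw [← ENNReal.prod_rpow_of_nonneg (inv_nonneg.2 hm.le)]
  refine (sum_prod_rpow_le S (fun i T => κ i T) (fun _ => inv_nonneg.2 hm.le) ?_).trans ?_
  · simp [hm.ne']
  · gcongr with i
    rw [← measure_biUnion_finset (f := fun T => T) hdisj hmeas]
    exact measure_mono (Set.iUnion₂_subset hR)

theorem Laminar.isSparse_of_principal [Nonempty ι] {κ : ι → Measure X}
    (hS : Laminar (S : Set (Set X))) (hmeas : ∀ Q ∈ S, MeasurableSet Q) (h0 : ∀ Q ∈ S, μ Q ≠ 0)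
    (htop : ∀ Q ∈ S, μ Q ≠ ∞) (hκ : ∀ i, ∀ Q ∈ S, κ i Q ≠ ∞) (hs : 0 ≤ s)
    (hs' : s ≤ Fintype.card ι)
    (hF : ∀ T ∈ S, ∀ R ∈ S, T ⊂ R →
      2 ^ Fintype.card ι * fracMean s μ κ R < fracMean s μ κ T) :
    IsSparse μ S := by
  classical
  intro R hR
  obtain ⟨H, hH, hdisj, hcov⟩ :=
    (hS.mono (Finset.coe_subset.2 (S.filter_subset (· ⊂ R)))).exists_disjoint_cover
  have hHS {T : Set X} (hT : T ∈ H) : T ∈ S ∧ T ⊂ R := Finset.mem_filter.1 (hH hT)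
  have hsub : descendants S R ⊆ ⋃ T ∈ H, T :=
    Set.iUnion₂_subset fun T hT => Set.iUnion_subset fun hTR => by
      obtain ⟨T', hT', hTT'⟩ := hcov T (Finset.mem_filter.2 ⟨hT, hTR⟩)
      exact Set.subset_iUnion₂_of_subset T' hT' hTT'
  set e := (Fintype.card ι : ℝ)⁻¹
  calc 2 * μ (descendants S R) ≤ ∑ T ∈ H, 2 * μ T := by
        rw [← Finset.mul_sum]
        gcongr
        exact (measure_mono hsub).trans (measure_biUnion_finset_le _ _)
    _ ≤ ∑ T ∈ H, μ R * ((∏ i, κ i T) ^ e / (∏ i, κ i R) ^ e) :=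
        Finset.sum_le_sum fun T hT => two_mul_measure_le_of_fracMean_lt hs hs' (hHS hT).2.le
          (h0 R hR) (htop R hR) (fun i => hκ i R hR) (hF T (hHS hT).1 R hR (hHS hT).2)
    _ = μ R * ((∑ T ∈ H, (∏ i, κ i T) ^ e) / (∏ i, κ i R) ^ e) := by
        simp only [div_eq_mul_inv, ← Finset.mul_sum, ← Finset.sum_mul]
    _ ≤ μ R * ((∏ i, κ i R) ^ e / (∏ i, κ i R) ^ e) := by
        gcongr
        exact sum_prod_measure_rpow_le (fun T hT => hmeas T (hHS hT).1) hdisj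
          fun T hT => (hHS hT).2.le
    _ ≤ μ R := mul_le_of_le_one_right' ENNReal.div_self_le_one

variable {P : ι → ℝ} {K : ℝ≥0∞}

theorem div_rpow_mul_le (hP : ∀ i, 1 < P i) (hq : 0 < q) {u v : ℝ≥0∞} (a σ : ι → ℝ≥0∞)
    (hK : v * ∏ i, σ i ^ (q / (P i).conjExponent) ≤ K * u ^ (q * s)) :
    ((∏ i, a i * σ i) / u ^ s) ^ q * v ≤ K * ∏ i, (a i ^ P i * σ i) ^ (q / P i) := by
  have hterm (i : ι) : (a i * σ i) ^ q =
      (a i ^ P i * σ i) ^ (q / P i) * σ i ^ (q / (P i).conjExponent) := by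
    have hPi : 0 < P i := by linarith [hP i]
    have hPi' : 0 < (P i).conjExponent := (Real.HolderConjugate.conjExponent (hP i)).symm.pos
    have hsum : q / P i + q / (P i).conjExponent = q := by
      rw [div_eq_mul_inv, div_eq_mul_inv, ← mul_add,
        (Real.HolderConjugate.conjExponent (hP i)).inv_add_inv_eq_one, mul_one]
    rw [ENNReal.mul_rpow_of_nonneg (a i ^ P i) _ (by positivity), ← ENNReal.rpow_mul,
      mul_div_cancel₀ _ hPi.ne', mul_assoc, ← ENNReal.rpow_add_of_nonneg _ _ (by positivity)
      (by positivity), hsum, ENNReal.mul_rpow_of_nonneg _ _ hq.le]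
  set D := ∏ i, (a i ^ P i * σ i) ^ (q / P i) with hD
  calc ((∏ i, a i * σ i) / u ^ s) ^ q * v
      = D * (v * ∏ i, σ i ^ (q / (P i).conjExponent)) / u ^ (q * s) := by
        rw [ENNReal.div_rpow_of_nonneg _ _ hq.le, ← ENNReal.rpow_mul, mul_comm s,
          ← ENNReal.prod_rpow_of_nonneg hq.le]
        simp only [hterm, Finset.prod_mul_distrib, div_eq_mul_inv, hD]
        ring
    _ ≤ D * (K * u ^ (q * s)) / u ^ (q * s) := by gcongr
    _ ≤ K * D := ENNReal.div_le_of_le_mul (by rw [mul_left_comm, mul_assoc])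

variable {σ : ι → Measure X} [∀ i, SFinite (σ i)] {g : ι → X → ℝ≥0∞}

theorem sum_fracMean_rpow_mul_le {Λ : ι → ℝ≥0∞} (hlam : Laminar (S : Set (Set X)))
    (hmeas : ∀ Q ∈ S, MeasurableSet Q) (hσ : ∀ i, ∀ Q ∈ S, σ i Q ≠ ∞)
    (hΛ : ∀ i, IsCarleson (σ i) (Λ i) S) (hg : ∀ i, AEMeasurable (g i) (σ i))
    (hP : ∀ i, 1 < P i) (hq : 0 < q) (hPq : 1 ≤ ∑ i, q / P i)
    (hK : ∀ Q ∈ S, ν Q * ∏ i, σ i Q ^ (q / (P i).conjExponent) ≤ K * μ Q ^ (q * s)) :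
    ∑ Q ∈ S, fracMean s μ (fun i => (σ i).withDensity (g i)) Q ^ q * ν Q ≤
      K * ∏ i, (carlesonConst (P i) * Λ i * ∫⁻ x, g i x ^ P i ∂σ i) ^ (q / P i) := by
  have hP0 (i : ι) : 0 ≤ q / P i := div_nonneg hq.le (by linarith [hP i])
  have hκ {Q : Set X} (hQ : Q ∈ S) (i : ι) :
      (σ i).withDensity (g i) Q = (⨍⁻ x in Q, g i x ∂σ i) * σ i Q := by
    rw [withDensity_apply _ (hmeas Q hQ), mul_comm, measure_mul_setLAverage _ (hσ i Q hQ)]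
  calc ∑ Q ∈ S, fracMean s μ (fun i => (σ i).withDensity (g i)) Q ^ q * ν Q
      ≤ ∑ Q ∈ S, K * ∏ i, ((⨍⁻ x in Q, g i x ∂σ i) ^ P i * σ i Q) ^ (q / P i) := by
        refine Finset.sum_le_sum fun Q hQ => ?_
        simp only [fracMean, hκ hQ]
        exact div_rpow_mul_le hP hq _ _ (hK Q hQ)
    _ ≤ K * ∏ i, (∑ Q ∈ S, (⨍⁻ x in Q, g i x ∂σ i) ^ P i * σ i Q) ^ (q / P i) := by
        rw [← Finset.mul_sum]
        gcongr
        exact sum_prod_rpow_le S (fun i Q => (⨍⁻ x in Q, g i x ∂σ i) ^ P i * σ i Q) hP0 hPq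
    _ ≤ _ := by
        gcongr with i
        · exact hP0 i
        · exact (hΛ i).sum_setLAverage_rpow_mul_le hlam hmeas (hg i) (hP i)

theorem Laminar.lintegral_maximalOver_fracMean_rpow_le {G : Set (Set X)} {L : ι → ℝ≥0∞}
    (hG : Laminar G) (hcount : G.Countable) (hmeas : ∀ Q ∈ G, MeasurableSet Q)
    (h0 : ∀ Q ∈ G, μ Q ≠ 0) (htop : ∀ Q ∈ G, μ Q ≠ ∞) (hσ : ∀ i, ∀ Q ∈ G, σ i Q ≠ ∞)
    (hg : ∀ i, AEMeasurable (g i) (σ i)) (hgG : ∀ i, ∀ Q ∈ G, (σ i).withDensity (g i) Q ≠ ∞)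
    (hP : ∀ i, 1 < P i) (hq : 0 < q) (hPq : 1 ≤ ∑ i, q / P i) (hs : 0 ≤ s)
    (hs' : s ≤ Fintype.card ι)
    (hK : ∀ Q ∈ G, ν Q * ∏ i, σ i Q ^ (q / (P i).conjExponent) ≤ K * μ Q ^ (q * s))
    (hL : ∀ i, HasAInftyBound G μ (σ i) (L i)) :
    ∫⁻ x, maximalOver G (fracMean s μ fun i => (σ i).withDensity (g i)) x ^ q ∂ν ≤
      (2 ^ Fintype.card ι) ^ q *
        (K * ∏ i, (carlesonConst (P i) * (2 * L i) * ∫⁻ x, g i x ^ P i ∂σ i) ^ (q / P i)) := by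
  have : Nonempty ι := by
    by_contra h
    rw [not_nonempty_iff] at h
    norm_num at hPq
  set F := fracMean s μ fun i => (σ i).withDensity (g i)
  simp_rw [maximalOver_rpow hq]
  refine lintegral_maximalOver_le_of_finite hcount hmeas fun T hTG hT => ?_
  obtain ⟨T, rfl⟩ := hT.exists_finset_coe
  obtain ⟨S, hST, hcov, hS⟩ := exists_principal F (one_le_pow₀ one_le_two) T
  have hSG : (S : Set (Set X)) ⊆ G := (Finset.coe_subset.2 hST).trans hTG
  have hlam : Laminar (S : Set (Set X)) := hG.mono hSG
  have hsparse : IsSparse μ S := hlam.isSparse_of_principal (fun Q hQ => hmeas Q (hSG hQ))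
    (fun Q hQ => h0 Q (hSG hQ)) (fun Q hQ => htop Q (hSG hQ)) (fun i Q hQ => hgG i Q (hSG hQ))
    hs hs' hS
  have hcarl (i : ι) : IsCarleson (σ i) (2 * L i) S :=
    hsparse.isCarleson hlam (fun Q hQ => hmeas Q (hSG hQ)) (fun Q hQ => h0 Q (hSG hQ))
      (fun Q hQ => htop Q (hSG hQ)) ((hL i).mono hSG)
  calc ∫⁻ x, maximalOver (T : Set (Set X)) (fun Q => F Q ^ q) x ∂ν
      ≤ ∫⁻ x, (2 ^ Fintype.card ι) ^ q * maximalOver (S : Set (Set X)) (fun Q => F Q ^ q) x ∂ν := by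
        refine lintegral_mono (maximalOver_le_mul_of_cover fun Q hQ => ?_)
        obtain ⟨R, hR, hQR, hle⟩ := hcov Q hQ
        refine ⟨R, hR, hQR, ?_⟩
        rw [← ENNReal.mul_rpow_of_nonneg _ _ hq.le]
        gcongr
    _ = (2 ^ Fintype.card ι) ^ q * ∫⁻ x, maximalOver (S : Set (Set X)) (fun Q => F Q ^ q) x ∂ν :=
        lintegral_const_mul' _ _ (by finiteness)
    _ ≤ (2 ^ Fintype.card ι) ^ q * ∑ R ∈ S, F R ^ q * ν R := by
        gcongr
        exact lintegral_maximalOver_le_sum fun Q hQ => hmeas Q (hSG hQ)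
    _ ≤ _ := by
        gcongr
        exact sum_fracMean_rpow_mul_le hlam (fun Q hQ => hmeas Q (hSG hQ))
          (fun i Q hQ => hσ i Q (hSG hQ)) hcarl hg hP hq hPq fun Q hQ => hK Q (hSG hQ)

end TwoWeight

/-! ### Cubes and dyadic grids -/

section Cubes

variable {n : ℕ} {Q R : Set (Fin n → ℝ)}

theorem volume_cube (a : Fin n → ℝ) (l : ℝ) :
    volume (Set.Icc a fun j => a j + l) = ENNReal.ofReal l ^ n := by
  rw [Real.volume_Icc_pi]
  simp

theorem IsCube.volume_ne_zero (hQ : IsCube Q) : volume Q ≠ 0 := by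
  obtain ⟨a, l, hl, rfl⟩ := hQ
  rw [volume_cube]
  exact pow_ne_zero _ (by simpa using hl)

theorem IsCube.isCompact (hQ : IsCube Q) : IsCompact Q := by
  obtain ⟨a, l, -, rfl⟩ := hQ
  exact isCompact_Icc

theorem IsCube.volume_ne_top (hQ : IsCube Q) : volume Q ≠ ∞ :=
  hQ.isCompact.measure_lt_top.ne

theorem isCube_closedBall (x : Fin n → ℝ) {r : ℝ} (hr : 0 < r) :
    IsCube (Metric.closedBall x r) := by
  refine ⟨fun j => x j - r, 2 * r, by positivity, ?_⟩
  rw [closedBall_pi _ hr.le, ← Set.pi_univ_Icc]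
  refine Set.pi_congr rfl fun j _ => ?_
  rw [Real.closedBall_eq_Icc]
  congr 1
  ring

theorem IsCube.exists_union_subset (hQ : IsCube Q) (hR : IsCube R) :
    ∃ T, IsCube T ∧ Q ∪ R ⊆ T := by
  obtain ⟨r, hr, hsub⟩ := (hQ.isCompact.union hR.isCompact).isBounded.subset_closedBall_lt 0 0
  exact ⟨_, isCube_closedBall 0 hr, hsub⟩

theorem ae_of_forall_isCube {p : (Fin n → ℝ) → Prop}
    (h : ∀ Q, IsCube Q → ∀ᵐ x ∂volume.restrict Q, p x) : ∀ᵐ x, p x := by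
  have hcover : ⋃ k : ℕ, Metric.closedBall (0 : Fin n → ℝ) (k + 1) = Set.univ := by
    refine Set.eq_univ_of_subset (Set.iUnion_mono fun k => ?_) (Metric.iUnion_closedBall_nat 0)
    exact Metric.closedBall_subset_closedBall (by linarith)
  rw [← Measure.restrict_univ (μ := volume), ← hcover, ae_restrict_iUnion_iff]
  exact fun k => h _ (isCube_closedBall 0 (by positivity))

end Cubes

section Grid

variable {n : ℕ} {β : Fin n → Bool} {Q R : Set (Fin n → ℝ)}

/-- The offset, relative to the side length `2 ^ k`, of the `k`-th generation of a one-dimensional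
dyadic grid: the standard one for `false`, the one shifted by a third for `true`. The sign of the
shift alternates with `k`, which makes the shifted generations nested. -/
noncomputable def gridOffset (b : Bool) (k : ℤ) : ℝ := if b then (-1) ^ k / 3 else 0

/-- The index of the cube of side `2 ^ k` of the grid `β` which contains `x`. -/
noncomputable def gridIndex (β : Fin n → Bool) (k : ℤ) (x : Fin n → ℝ) : Fin n → ℤ :=
  fun j => ⌊x j / 2 ^ k - gridOffset (β j) k⌋

/-- The half-open dyadic cube of side `2 ^ r.1` with index `r.2` of the grid `β`. -/
def gridCube (β : Fin n → Bool) (r : ℤ × (Fin n → ℤ)) : Set (Fin n → ℝ) :=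
  {x | gridIndex β r.1 x = r.2}

/-- The dyadic grid shifted by a third in the directions where `β` is `true`. -/
def grid (β : Fin n → Bool) : Set (Set (Fin n → ℝ)) :=
  Set.range (gridCube β)

theorem countable_grid : (grid β).Countable :=
  Set.countable_range _

theorem gridCube_eq_pi (β : Fin n → Bool) (r : ℤ × (Fin n → ℤ)) :
    ∃ a : Fin n → ℝ, gridCube β r = Set.univ.pi fun j => Set.Ico (a j) (a j + 2 ^ r.1) := by
  refine ⟨fun j => 2 ^ r.1 * (r.2 j + gridOffset (β j) r.1), ?_⟩
  ext x
  have h2 : (0 : ℝ) < 2 ^ r.1 := by positivity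
  simp only [gridCube, Set.mem_ofPred_eq, funext_iff, gridIndex, Set.mem_pi, Set.mem_univ,
    true_imp_iff, Set.mem_Ico, Int.floor_eq_iff]
  refine forall_congr' fun j => and_congr ?_ ?_
  · rw [le_sub_iff_add_le, le_div_iff₀ h2, mul_comm]
  · rw [sub_lt_iff_lt_add, div_lt_iff₀ h2]
    ring_nf

theorem volume_gridCube (β : Fin n → Bool) (r : ℤ × (Fin n → ℤ)) :
    volume (gridCube β r) = ENNReal.ofReal (2 ^ r.1) ^ n := by
  obtain ⟨a, ha⟩ := gridCube_eq_pi β r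
  rw [ha, Real.volume_pi_Ico]
  simp

theorem measurableSet_of_mem_grid (hQ : Q ∈ grid β) : MeasurableSet Q := by
  obtain ⟨r, rfl⟩ := hQ
  obtain ⟨a, ha⟩ := gridCube_eq_pi β r
  rw [ha]
  exact MeasurableSet.univ_pi fun j => measurableSet_Ico

theorem exists_isCube_ae_eq (hQ : Q ∈ grid β) : ∃ T, IsCube T ∧ Q ⊆ T ∧ Q =ᵐ[volume] T := by
  obtain ⟨r, rfl⟩ := hQ
  obtain ⟨a, ha⟩ := gridCube_eq_pi β r
  refine ⟨_, ⟨a, 2 ^ r.1, by positivity, rfl⟩, ?_⟩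
  rw [ha]
  exact ⟨fun x hx => ⟨fun j => (hx j trivial).1, fun j => (hx j trivial).2.le⟩,
    Measure.univ_pi_Ico_ae_eq_Icc⟩

theorem volume_ne_zero_of_mem_grid (hQ : Q ∈ grid β) : volume Q ≠ 0 := by
  obtain ⟨T, hT, -, h⟩ := exists_isCube_ae_eq hQ
  exact (measure_congr h).trans_ne hT.volume_ne_zero

theorem volume_ne_top_of_mem_grid (hQ : Q ∈ grid β) : volume Q ≠ ∞ := by
  obtain ⟨T, hT, -, h⟩ := exists_isCube_ae_eq hQ
  exact (measure_congr h).trans_ne hT.volume_ne_top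

theorem gridOffset_succ (b : Bool) (k : ℤ) :
    ∃ z : ℤ, gridOffset b (k + 1) = (gridOffset b k - z) / 2 := by
  cases b
  · exact ⟨0, by simp [gridOffset]⟩
  · refine ⟨if Even k then 1 else -1, ?_⟩
    simp only [gridOffset, if_true, zpow_add_one₀ (show (-1 : ℝ) ≠ 0 by norm_num)]
    rcases Int.even_or_odd k with h | h
    · norm_num [h.neg_one_zpow, h]
    · norm_num [h.neg_one_zpow, Int.not_even_iff_odd.2 h]

theorem gridIndex_succ (k : ℤ) {x y : Fin n → ℝ} (h : gridIndex β k x = gridIndex β k y) :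
    gridIndex β (k + 1) x = gridIndex β (k + 1) y := by
  funext j
  obtain ⟨z, hz⟩ := gridOffset_succ (β j) k
  have hhalf (x : Fin n → ℝ) : gridIndex β (k + 1) x j = (gridIndex β k x j + z) / 2 := by
    have harg : x j / 2 ^ (k + 1) - gridOffset (β j) (k + 1) =
        (x j / 2 ^ k - gridOffset (β j) k + z) / (2 : ℕ) := by
      rw [hz, zpow_add_one₀ two_ne_zero]
      push_cast
      field_simp
      ring
    simp only [gridIndex]
    rw [harg, Int.floor_div_natCast, Int.floor_add_intCast]
    rfl
  rw [hhalf, hhalf, h]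

theorem gridIndex_congr_of_le {k l : ℤ} (hkl : k ≤ l) {x y : Fin n → ℝ}
    (h : gridIndex β k x = gridIndex β k y) : gridIndex β l x = gridIndex β l y := by
  induction l, hkl using Int.leInduction with
  | base => exact h
  | succ l _ ih => exact gridIndex_succ l ih

theorem laminar_grid (β : Fin n → Bool) : Laminar (grid β) := by
  have hnested {r t : ℤ × (Fin n → ℤ)} (hrt : r.1 ≤ t.1) :
      gridCube β r ⊆ gridCube β t ∨ Disjoint (gridCube β r) (gridCube β t) := by
    rw [or_iff_not_imp_right, Set.not_disjoint_iff]
    rintro ⟨x, hxr, hxt⟩ y hy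
    exact (gridIndex_congr_of_le hrt (Eq.trans hy (Eq.symm hxr))).trans hxt
  rintro _ ⟨r, rfl⟩ _ ⟨t, rfl⟩
  rcases le_total r.1 t.1 with h | h
  · exact (hnested h).imp_right Or.inr
  · exact Or.inr ((hnested h).imp_right fun h => h.symm)

theorem exists_floor_sub_gridOffset_eq (u : ℝ) (k : ℤ) :
    ∃ b, ∀ v, u ≤ v → v < u + 1 / 3 → ⌊v - gridOffset b k⌋ = ⌊u - gridOffset b k⌋ := by
  have hconst {c : ℝ} {z : ℤ} (h₁ : z ≤ u - c) (h₂ : u - c + 1 / 3 ≤ z + 1) (v : ℝ) (huv : u ≤ v)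
      (hv : v < u + 1 / 3) : ⌊v - c⌋ = ⌊u - c⌋ :=
    (Int.floor_eq_iff.2 ⟨by linarith, by linarith⟩).trans
      (Int.floor_eq_iff.2 ⟨h₁, by linarith⟩).symm
  have hle := Int.floor_le u
  have hlt := Int.lt_floor_add_one u
  by_cases h : u + 1 / 3 ≤ ⌊u⌋ + 1
  · exact ⟨false, hconst (z := ⌊u⌋) (by simpa [gridOffset] using hle)
      (by simpa [gridOffset] using h)⟩
  refine ⟨true, ?_⟩
  rcases Int.even_or_odd k with hk | hk <;> simp only [gridOffset, if_true, hk.neg_one_zpow]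
  · exact hconst (z := ⌊u⌋) (by linarith) (by linarith)
  · exact hconst (z := ⌊u⌋ + 1) (by push_cast; linarith) (by push_cast; linarith)

theorem IsCube.exists_mem_grid (hQ : IsCube Q) :
    ∃ R ∈ ⋃ β : Fin n → Bool, grid β, Q ⊆ R ∧ volume R ≤ 6 ^ n * volume Q := by
  obtain ⟨a, l, hl, rfl⟩ := hQ
  obtain ⟨k, hk, hk'⟩ := exists_mem_Ico_zpow (show 0 < 3 * l by positivity) one_lt_two
  have h2 : (0 : ℝ) < 2 ^ (k + 1) := by positivity
  choose β hβ using fun j => exists_floor_sub_gridOffset_eq (a j / 2 ^ (k + 1)) (k + 1)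
  refine ⟨gridCube β (k + 1, gridIndex β (k + 1) a), Set.mem_iUnion.2 ⟨β, _, rfl⟩,
    fun x hx => funext fun j => hβ j _ ?_ ?_, ?_⟩
  · have := hx.1 j
    gcongr
  · have : x j ≤ a j + l := hx.2 j
    rw [div_lt_iff₀ h2, add_mul, div_mul_cancel₀ _ h2.ne']
    linarith
  · have hside : (2 : ℝ) ^ (k + 1) ≤ 6 * l := by
      rw [zpow_add_one₀ two_ne_zero]
      linarith
    rw [volume_gridCube, volume_cube, ← mul_pow]
    gcongr
    rw [← ENNReal.ofReal_ofNat 6, ← ENNReal.ofReal_mul (by norm_num)]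
    exact ENNReal.ofReal_le_ofReal hside

theorem IsCube.exists_grid_fracMean_le {ι : Type*} [Fintype ι] {s : ℝ} (hs : 0 ≤ s)
    (κ : ι → Measure (Fin n → ℝ)) (hQ : IsCube Q) :
    ∃ R ∈ ⋃ β : Fin n → Bool, grid β, Q ⊆ R ∧
      fracMean s volume κ Q ≤ (6 ^ n) ^ s * fracMean s volume κ R := by
  obtain ⟨R, hR, hQR, hvol⟩ := hQ.exists_mem_grid
  refine ⟨R, hR, hQR, ENNReal.div_le_of_le_mul ?_⟩
  obtain ⟨β, hβ⟩ := Set.mem_iUnion.1 hR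
  have h0 : volume R ^ s ≠ 0 :=
    (ENNReal.rpow_pos (pos_of_ne_zero (volume_ne_zero_of_mem_grid hβ))
      (volume_ne_top_of_mem_grid hβ)).ne'
  have htop : volume R ^ s ≠ ∞ := ENNReal.rpow_ne_top_of_nonneg hs (volume_ne_top_of_mem_grid hβ)
  calc ∏ i, κ i Q ≤ ∏ i, κ i R := Finset.prod_le_prod' fun i _ => measure_mono hQR
    _ = fracMean s volume κ R * volume R ^ s := (ENNReal.div_mul_cancel h0 htop).symm
    _ ≤ fracMean s volume κ R * (6 ^ n * volume Q) ^ s := by gcongr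
    _ = (6 ^ n) ^ s * fracMean s volume κ R * volume Q ^ s := by
        rw [ENNReal.mul_rpow_of_nonneg _ _ hs]
        ring

theorem fractionalMaximal_eq {m : ℕ} (hm : m ≠ 0) (α : ℝ) (f : Fin m → (Fin n → ℝ) → ℂ) :
    fractionalMaximal α f = maximalOver {Q | IsCube Q}
      (fracMean (m - α / n) volume fun i => volume.withDensity fun y => ‖f i y‖ₑ) := by
  have hm' : (m : ℝ) ≠ 0 := by exact_mod_cast hm
  have hprod (Q : Set (Fin n → ℝ)) :
      ∏ i, (∫⁻ y in Q, ‖f i y‖ₑ) / volume Q ^ (1 - α / ((m : ℝ) * n)) =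
        fracMean (m - α / n) volume (fun i => volume.withDensity fun y => ‖f i y‖ₑ) Q := by
    have hexp : (m : ℝ) - α / n = (1 - α / ((m : ℝ) * n)) * m := by
      rw [sub_mul, one_mul, div_mul_eq_mul_div, mul_comm α, mul_div_mul_left _ _ hm']
    rw [fracMean, hexp, ENNReal.rpow_mul, ENNReal.rpow_natCast]
    simp [div_eq_mul_inv, Finset.prod_mul_distrib, ENNReal.inv_pow, withDensity_apply']
  funext x
  simp only [fractionalMaximal, maximalOver, hprod, Set.mem_ofPred_eq]

theorem fractionalMaximal_rpow_le {m : ℕ} (hm : m ≠ 0) {α q : ℝ} (hq : 0 < q)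
    (hs : 0 ≤ m - α / n) (f : Fin m → (Fin n → ℝ) → ℂ) (x : Fin n → ℝ) :
    fractionalMaximal α f x ^ q ≤ (((6 : ℝ≥0∞) ^ n) ^ (m - α / n)) ^ q *
      ∑ β : Fin n → Bool, maximalOver (grid β)
        (fracMean (m - α / n) volume fun i => volume.withDensity fun y => ‖f i y‖ₑ) x ^ q := by
  simp_rw [fractionalMaximal_eq hm, maximalOver_rpow hq]
  refine (maximalOver_le_mul_of_cover (fun Q hQ => ?_) x).trans
    (mul_le_mul_right (maximalOver_iUnion_le_sum grid x) _)
  obtain ⟨R, hR, hQR, h⟩ := IsCube.exists_grid_fracMean_le hs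
    (fun i => volume.withDensity fun y => ‖f i y‖ₑ) hQ
  refine ⟨R, hR, hQR, ?_⟩
  rw [← ENNReal.mul_rpow_of_nonneg _ _ hq.le]
  gcongr

end Grid

/-! ### Weights -/

section Weights

variable {n m : ℕ} {P : Fin m → ℝ} {p q : ℝ} {ω : Fin m → (Fin n → ℝ) → ℝ≥0}
  {w : (Fin n → ℝ) → ℝ≥0} {σ : (Fin n → ℝ) → ℝ≥0∞} {β : Fin n → Bool} {Q R T : Set (Fin n → ℝ)}

theorem conjExponent_pos (hp : 1 < p) : 0 < p.conjExponent :=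
  (Real.HolderConjugate.conjExponent hp).symm.pos

theorem prod_rpow_eq_rpow_sum {ι : Type*} {s : Finset ι} (u : ℝ≥0∞) {e : ι → ℝ}
    (he : ∀ i ∈ s, 0 ≤ e i) : ∏ i ∈ s, u ^ e i = u ^ ∑ i ∈ s, e i := by
  induction s using Finset.cons_induction with
  | empty => simp
  | cons a s ha ih =>
    rw [Finset.forall_mem_cons] at he
    rw [Finset.prod_cons, Finset.sum_cons, ih he.2,
      ENNReal.rpow_add_of_nonneg _ _ he.1 (Finset.sum_nonneg he.2)]

theorem mul_prod_rpow_eq_of_ne_zero {ι : Type*} [Fintype ι] {u : ℝ≥0∞} (hu : u ≠ 0) (hu' : u ≠ ∞)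
    (v : ℝ≥0∞) (s : ι → ℝ≥0∞) {e : ι → ℝ} (he : ∀ i, 0 ≤ e i) :
    v * ∏ i, s i ^ e i = (v / u * ∏ i, (s i / u) ^ e i) * u ^ (1 + ∑ i, e i) := by
  have hsplit (i : ι) : s i ^ e i = (s i / u) ^ e i * u ^ e i := by
    rw [← ENNReal.mul_rpow_of_nonneg _ _ (he i), ENNReal.div_mul_cancel hu hu']
  rw [ENNReal.rpow_add_of_nonneg _ _ zero_le_one (Finset.sum_nonneg fun i _ => he i),
    ENNReal.rpow_one, ← prod_rpow_eq_rpow_sum u fun i _ => he i]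
  calc v * ∏ i, s i ^ e i
      = (v / u * u) * ((∏ i, (s i / u) ^ e i) * ∏ i, u ^ e i) := by
        rw [ENNReal.div_mul_cancel hu hu', ← Finset.prod_mul_distrib]
        simp_rw [hsplit]
    _ = _ := by ring

theorem powMeasure_mul_prod_dualWeight_le (hP : ∀ i, 1 < P i) (hq : 0 ≤ q) (hQ : IsCube Q) :
    powMeasure (prodWeight ω) q Q *
        ∏ i, volume.withDensity (dualWeight (P i) (ω i)) Q ^ (q / (P i).conjExponent) ≤
      aConst P q ω * volume Q ^ (1 + ∑ i, q / (P i).conjExponent) := by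
  rw [mul_prod_rpow_eq_of_ne_zero hQ.volume_ne_zero hQ.volume_ne_top _ _
    fun i => div_nonneg hq (conjExponent_pos (hP i)).le]
  gcongr
  simp only [powMeasure, withDensity_apply', ← setLAverage_eq]
  exact le_iSup₂ (f := fun Q (_ : IsCube Q) => (⨍⁻ x in Q, prodWeight ω x ^ q ∂volume) *
    ∏ i, (⨍⁻ x in Q, dualWeight (P i) (ω i) x ∂volume) ^ (q / (P i).conjExponent)) Q hQ

theorem powMeasure_mul_prod_dualWeight_le_of_mem_grid (hP : ∀ i, 1 < P i) (hq : 0 ≤ q)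
    (hQ : Q ∈ grid β) :
    powMeasure (prodWeight ω) q Q *
        ∏ i, volume.withDensity (dualWeight (P i) (ω i)) Q ^ (q / (P i).conjExponent) ≤
      aConst P q ω * volume Q ^ (1 + ∑ i, q / (P i).conjExponent) := by
  obtain ⟨T, hT, -, hQT⟩ := exists_isCube_ae_eq hQ
  have hcongr (h : (Fin n → ℝ) → ℝ≥0∞) : volume.withDensity h Q = volume.withDensity h T :=
    measure_congr ((withDensity_absolutelyContinuous volume h).ae_eq hQT)
  simp only [powMeasure, hcongr, measure_congr hQT]
  exact powMeasure_mul_prod_dualWeight_le hP hq hT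

theorem maximalOver_average_le_hardyLittlewoodMaximal (hRT : R ⊆ T) (x : Fin n → ℝ) :
    maximalOver {Q ∈ grid β | Q ⊆ R} (fun Q => volume.withDensity σ Q / volume Q) x ≤
      hardyLittlewoodMaximal (T.indicator σ) x := by
  refine maximalOver_le_iff.2 fun Q ⟨hQ, hQR⟩ hx => ?_
  obtain ⟨S, hS, hQS, hae⟩ := exists_isCube_ae_eq hQ
  calc volume.withDensity σ Q / volume Q
      = ⨍⁻ y in S, T.indicator σ y ∂volume := by
        rw [withDensity_apply', setLAverage_eq, ← setLIntegral_congr hae, measure_congr hae]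
        congr 1
        refine setLIntegral_congr_fun (measurableSet_of_mem_grid hQ) fun y hy => ?_
        exact (Set.indicator_of_mem (hRT (hQR hy)) σ).symm
    _ ≤ hardyLittlewoodMaximal (T.indicator σ) x :=
        le_iSup_of_le S (le_iSup₂_of_le hS (hQS hx) le_rfl)

theorem hasAInftyBound_grid (h0 : ∀ Q, IsCube Q → ∫⁻ x in Q, σ x ≠ 0)
    (htop : ∀ Q, IsCube Q → ∫⁻ x in Q, σ x ≠ ∞) :
    HasAInftyBound (grid β) volume (volume.withDensity σ) (aInftyConst σ) := by
  intro R hR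
  obtain ⟨T, hT, hRT, hae⟩ := exists_isCube_ae_eq hR
  calc ∫⁻ x in R, maximalOver {Q ∈ grid β | Q ⊆ R}
        (fun Q => volume.withDensity σ Q / volume Q) x
      ≤ ∫⁻ x in T, hardyLittlewoodMaximal (T.indicator σ) x := by
        rw [setLIntegral_congr hae]
        exact lintegral_mono fun x => maximalOver_average_le_hardyLittlewoodMaximal hRT x
    _ ≤ aInftyConst σ * ∫⁻ x in T, σ x := by
        rw [← ENNReal.div_le_iff (h0 T hT) (htop T hT)]
        exact le_iSup₂ (f := fun Q (_ : IsCube Q) =>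
          (∫⁻ x in Q, hardyLittlewoodMaximal (Q.indicator σ) x) / ∫⁻ x in Q, σ x) T hT
    _ = aInftyConst σ * volume.withDensity σ R := by
        rw [withDensity_apply', setLIntegral_congr hae]

theorem dualWeight_ne_zero (hp : 1 < p) (w : (Fin n → ℝ) → ℝ≥0) (x : Fin n → ℝ) :
    dualWeight p w x ≠ 0 := by
  simp [dualWeight, ENNReal.rpow_eq_zero_iff, (conjExponent_pos hp).le]

theorem aemeasurable_dualWeight (p : ℝ) (hw : AEMeasurable w) : AEMeasurable (dualWeight p w) :=
  hw.coe_nnreal_ennreal.pow_const _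

theorem aemeasurable_prodWeight (hω : ∀ i, AEMeasurable (ω i)) : AEMeasurable (prodWeight ω) :=
  Finset.aemeasurable_fun_prod _ fun i _ => (hω i).coe_nnreal_ennreal

theorem setLIntegral_dualWeight_ne_zero (hp : 1 < p) (hw : AEMeasurable w) (hQ : IsCube Q) :
    ∫⁻ x in Q, dualWeight p w x ≠ 0 := by
  rw [← withDensity_apply']
  exact fun h => hQ.volume_ne_zero (withDensity_absolutelyContinuous'
    (aemeasurable_dualWeight p hw) (ae_of_all _ (dualWeight_ne_zero hp w)) h)

theorem ae_ne_zero_of_setLIntegral_dualWeight_ne_top (hp : 1 < p) (hw : AEMeasurable w)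
    (h : ∀ Q, IsCube Q → ∫⁻ x in Q, dualWeight p w x ≠ ∞) : ∀ᵐ x, w x ≠ 0 := by
  refine ae_of_forall_isCube fun Q hQ => ?_
  filter_upwards [ae_lt_top' (aemeasurable_dualWeight p hw).restrict (h Q hQ)] with x hx h0
  simp [dualWeight, h0, conjExponent_pos hp] at hx

theorem MemA.setLIntegral_prodWeight_eq_zero (hP : ∀ i, 1 < P i) (hq : 0 < q) (hω : MemA P q ω)
    (hT : IsCube T) {i : Fin m} (htop : ∫⁻ x in T, dualWeight (P i) (ω i) x = ∞) :
    ∫⁻ x in T, prodWeight ω x ^ q = 0 := by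
  have hpos (j : Fin m) : 0 < 1 / (P j).conjExponent := one_div_pos.2 (conjExponent_pos (hP j))
  have hprod : ∏ j, (⨍⁻ x in T, dualWeight (P j) (ω j) x ∂volume) ^ (1 / (P j).conjExponent)
      = ∞ := by
    rw [← Finset.mul_prod_erase _ _ (Finset.mem_univ i), setLAverage_eq, htop,
      ENNReal.top_div_of_ne_top hT.volume_ne_top, ENNReal.top_rpow_of_pos (hpos i)]
    refine ENNReal.top_mul (Finset.prod_ne_zero_iff.2 fun j _ => ?_)
    rw [setLAverage_eq, ne_eq, ENNReal.rpow_eq_zero_iff_of_pos (hpos j), ENNReal.div_eq_zero_iff]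
    simp [setLIntegral_dualWeight_ne_zero (hP j) (hω.1 j) hT, hT.volume_ne_top]
  have hlt := (le_iSup₂ (f := fun Q (_ : IsCube Q) =>
    (⨍⁻ x in Q, prodWeight ω x ^ q ∂volume) ^ (1 / q) *
      ∏ j, (⨍⁻ x in Q, dualWeight (P j) (ω j) x ∂volume) ^ (1 / (P j).conjExponent))
    T hT).trans_lt hω.2
  by_contra hne
  rw [hprod, ENNReal.mul_top] at hlt
  · exact lt_irrefl _ hlt
  · rw [setLAverage_eq, ne_eq, ENNReal.rpow_eq_zero_iff_of_pos (one_div_pos.2 hq),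
      ENNReal.div_eq_zero_iff]
    simp [hne, hT.volume_ne_top]

theorem MemA.powMeasure_eq_zero (hP : ∀ i, 1 < P i) (hq : 0 < q) (hω : MemA P q ω)
    (hQ : IsCube Q) {i : Fin m} (htop : ∫⁻ x in Q, dualWeight (P i) (ω i) x = ∞) :
    powMeasure (prodWeight ω) q = 0 := by
  have hmeas : AEMeasurable fun x => prodWeight ω x ^ q :=
    (aemeasurable_prodWeight hω.1).pow_const q
  refine (withDensity_eq_zero_iff hmeas).2 (ae_of_forall_isCube fun R hR => ?_)
  obtain ⟨T, hT, hsub⟩ := hQ.exists_union_subset hR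
  have htop' : ∫⁻ x in T, dualWeight (P i) (ω i) x = ∞ :=
    top_le_iff.1 (htop ▸ lintegral_mono_set (Set.union_subset_iff.1 hsub).1)
  have hzero := hω.setLIntegral_prodWeight_eq_zero hP hq hT htop'
  exact ae_restrict_of_ae_restrict_of_subset (Set.union_subset_iff.1 hsub).2
    ((lintegral_eq_zero_iff' hmeas.restrict).1 hzero)

theorem withDensity_dualWeight_withDensity (p : ℝ) (hw : AEMeasurable w) (h0 : ∀ᵐ x, w x ≠ 0)
    {a : (Fin n → ℝ) → ℝ≥0∞} (ha : AEMeasurable a) :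
    (volume.withDensity (dualWeight p w)).withDensity
      (fun x => a x * (w x : ℝ≥0∞) ^ p.conjExponent) = volume.withDensity a := by
  rw [← withDensity_mul₀ (aemeasurable_dualWeight p hw)
    (ha.fun_mul (hw.coe_nnreal_ennreal.pow_const _))]
  refine withDensity_congr_ae ?_
  filter_upwards [h0] with x hx
  have hx' : (w x : ℝ≥0∞) ≠ 0 := by exact_mod_cast hx
  rw [Pi.mul_apply, dualWeight, mul_left_comm, ← ENNReal.rpow_add _ _ hx' ENNReal.coe_ne_top,
    neg_add_cancel, ENNReal.rpow_zero, mul_one]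

theorem lintegral_rpow_withDensity_dualWeight (hp : 1 < p) (hw : AEMeasurable w)
    (h0 : ∀ᵐ x, w x ≠ 0) {a : (Fin n → ℝ) → ℝ≥0∞} (ha : AEMeasurable a) :
    ∫⁻ x, (a x * (w x : ℝ≥0∞) ^ p.conjExponent) ^ p ∂volume.withDensity (dualWeight p w) =
      ∫⁻ x, a x ^ p ∂powMeasure (fun x => w x) p := by
  have hw' (r : ℝ) : AEMeasurable fun x => (w x : ℝ≥0∞) ^ r := hw.coe_nnreal_ennreal.pow_const r
  rw [powMeasure, lintegral_withDensity_eq_lintegral_mul₀ (hw' p) (ha.pow_const p),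
    lintegral_withDensity_eq_lintegral_mul₀ (aemeasurable_dualWeight p hw)
      ((ha.fun_mul (hw' _)).pow_const p)]
  refine lintegral_congr_ae ?_
  filter_upwards [h0] with x hx
  have hx' : (w x : ℝ≥0∞) ≠ 0 := by exact_mod_cast hx
  have hexp : -p.conjExponent + p.conjExponent * p = p := by
    linarith [(Real.HolderConjugate.conjExponent hp).mul_eq_add]
  rw [Pi.mul_apply, Pi.mul_apply, dualWeight, ENNReal.mul_rpow_of_nonneg _ _ (by linarith),
    ← ENNReal.rpow_mul, mul_left_comm, ← ENNReal.rpow_add _ _ hx' ENNReal.coe_ne_top, hexp,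
    mul_comm]

end Weights

section Maximal

variable {n m : ℕ} {P : Fin m → ℝ} {q α : ℝ}

theorem sum_one_div_le_card (hP : ∀ i, 1 < P i) : ∑ i, 1 / P i ≤ m := by
  calc ∑ i, 1 / P i ≤ ∑ _i : Fin m, 1 :=
        Finset.sum_le_sum fun i _ => (div_le_one (by linarith [hP i])).2 (hP i).le
    _ = m := by simp

theorem one_add_sum_div_conjExponent {r : ℝ} (hP : ∀ i, 1 < P i) (hq : 0 < q)
    (hr : 1 / q = ∑ i, 1 / P i - r) : 1 + ∑ i, q / (P i).conjExponent = q * (m - r) := by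
  have hconj (i : Fin m) : q / (P i).conjExponent = q * (1 - 1 / P i) := by
    have := (Real.HolderConjugate.conjExponent (hP i)).inv_add_inv_eq_one
    rw [div_eq_mul_inv, one_div, eq_sub_iff_add_eq'.2 this]
  simp_rw [hconj, ← Finset.mul_sum, Finset.sum_sub_distrib, eq_add_of_sub_eq hr.symm]
  rw [Finset.sum_const, Finset.card_univ, Fintype.card_fin, nsmul_one]
  field_simp
  ring

theorem lintegral_maximalOver_grid_rpow_le {s : ℝ} (hP : ∀ i, 1 < P i) (hq : 0 < q)
    (hPq : 1 ≤ ∑ i, q / P i) (hs : 0 ≤ s) (hs' : s ≤ m)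
    (hexp : 1 + ∑ i, q / (P i).conjExponent = q * s) {ω : Fin m → (Fin n → ℝ) → ℝ≥0}
    (hω : ∀ i, AEMeasurable (ω i))
    (hfin : ∀ i Q, IsCube Q → ∫⁻ x in Q, dualWeight (P i) (ω i) x ≠ ∞)
    {f : Fin m → (Fin n → ℝ) → ℂ} (hf : ∀ i, LocallyIntegrable (f i)) (β : Fin n → Bool) :
    ∫⁻ x, maximalOver (grid β)
        (fracMean s volume fun i => volume.withDensity fun y => ‖f i y‖ₑ) x ^ q
        ∂powMeasure (prodWeight ω) q ≤
      (2 ^ m) ^ q * (aConst P q ω * ∏ i, (carlesonConst (P i) *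
        (2 * aInftyConst (dualWeight (P i) (ω i))) *
          ∫⁻ x, ‖f i x‖ₑ ^ P i ∂powMeasure (fun x => ω i x) (P i)) ^ (q / P i)) := by
  have hne (i : Fin m) := ae_ne_zero_of_setLIntegral_dualWeight_ne_top (hP i) (hω i) (hfin i)
  have hfm (i : Fin m) : AEMeasurable fun y => ‖f i y‖ₑ := (hf i).aestronglyMeasurable.enorm
  have hdens (i : Fin m) := withDensity_dualWeight_withDensity (P i) (hω i) (hne i) (hfm i)
  have htop {h : (Fin n → ℝ) → ℝ≥0∞} (hh : ∀ Q, IsCube Q → ∫⁻ x in Q, h x ≠ ∞) :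
      ∀ Q ∈ grid β, volume.withDensity h Q ≠ ∞ := fun Q hQ => by
    obtain ⟨T, hT, hQT, -⟩ := exists_isCube_ae_eq hQ
    rw [withDensity_apply']
    exact ((lintegral_mono_set hQT).trans_lt (hh T hT).lt_top).ne
  have hmain := (laminar_grid β).lintegral_maximalOver_fracMean_rpow_le
    (ν := powMeasure (prodWeight ω) q)
    countable_grid (fun _ => measurableSet_of_mem_grid) (fun _ => volume_ne_zero_of_mem_grid)
    (fun _ => volume_ne_top_of_mem_grid) (fun i => htop (hfin i))
    (fun i => ((hfm i).mul ((hω i).coe_nnreal_ennreal.pow_const (P i).conjExponent)).mono_ac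
      (withDensity_absolutelyContinuous _ _))
    (fun i => (hdens i).symm ▸ htop fun Q hQ => ((hf i).integrableOn_isCompact hQ.isCompact).2.ne)
    hP hq hPq hs (by simpa using hs')
    (fun Q hQ => hexp ▸ powMeasure_mul_prod_dualWeight_le_of_mem_grid hP hq.le hQ)
    (fun i => hasAInftyBound_grid
      (fun _ => setLIntegral_dualWeight_ne_zero (hP i) (hω i)) (hfin i))
  simpa only [Pi.mul_def, hdens, Fintype.card_fin,
    fun i => lintegral_rpow_withDensity_dualWeight (hP i) (hω i) (hne i) (hfm i)] using hmain

theorem lintegral_fractionalMaximal_rpow_le (hP : ∀ i, 1 < P i) (hα : 0 ≤ α) (hq : 0 < q)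
    (hαq : 1 / q = ∑ i, 1 / P i - α / n) {ω : Fin m → (Fin n → ℝ) → ℝ≥0} (hω : MemA P q ω)
    {f : Fin m → (Fin n → ℝ) → ℂ} (hf : ∀ i, LocallyIntegrable (f i)) :
    ∫⁻ x, fractionalMaximal α f x ^ q ∂powMeasure (prodWeight ω) q ≤
      ((6 ^ n) ^ (m - α / n)) ^ q * 2 ^ n * (2 ^ m) ^ q * aConst P q ω * ∏ i,
        (carlesonConst (P i) * (2 * aInftyConst (dualWeight (P i) (ω i))) *
          ∫⁻ x, ‖f i x‖ₑ ^ P i ∂powMeasure (fun x => ω i x) (P i)) ^ (q / P i) := by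
  by_cases hfin : ∀ i Q, IsCube Q → ∫⁻ x in Q, dualWeight (P i) (ω i) x ≠ ∞
  swap
  · push Not at hfin
    obtain ⟨i, Q, hQ, htop⟩ := hfin
    simp [hω.powMeasure_eq_zero hP hq hQ htop]
  have hαn : 0 ≤ α / n := by positivity
  have hq' : 0 < 1 / q := by positivity
  have hm : m ≠ 0 := by
    rintro rfl
    simp only [Finset.univ_eq_empty, Finset.sum_empty] at hαq
    linarith
  have hPq : 1 ≤ ∑ i, q / P i := by
    calc 1 = q * (1 / q) := by field_simp
      _ ≤ q * ∑ i, 1 / P i := by gcongr; linarith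
      _ = ∑ i, q / P i := by simp [Finset.mul_sum, div_eq_mul_inv]
  have hs : 0 ≤ m - α / n := by linarith [sum_one_div_le_card hP]
  refine (lintegral_mono (fractionalMaximal_rpow_le hm hq hs f)).trans ?_
  have hmeas (β : Fin n → Bool) := (measurable_maximalOver (F := fracMean (m - α / n) volume
    fun i => volume.withDensity fun y => ‖f i y‖ₑ) countable_grid
      fun _ => measurableSet_of_mem_grid (β := β)).pow_const q
  rw [lintegral_const_mul _ (Finset.measurable_fun_sum _ fun β _ => hmeas β),
    lintegral_finsetSum _ fun β _ => hmeas β]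
  refine (mul_le_mul_right (Finset.sum_le_sum fun β _ => lintegral_maximalOver_grid_rpow_le hP hq
    hPq hs (by linarith) (one_add_sum_div_conjExponent hP hq hαq) hω.1 hfin hf β) _).trans_eq ?_
  simp [mul_assoc]

theorem eLpNorm_ofReal_eq_lintegral_rpow_enorm {X E : Type*} [MeasurableSpace X] [ENorm E]
    (f : X → E) (μ : Measure X) {r : ℝ} (hr : 0 < r) :
    eLpNorm f (ENNReal.ofReal r) μ = (∫⁻ x, ‖f x‖ₑ ^ r ∂μ) ^ (1 / r) := by
  rw [eLpNorm_eq_lintegral_rpow_enorm_toReal (by simpa using hr) ENNReal.ofReal_ne_top,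
    ENNReal.toReal_ofReal hr.le]

theorem mul_prod_rpow_rpow_one_div {ι : Type*} [Fintype ι] {P : ι → ℝ} (hP : ∀ i, 0 < P i) {q : ℝ}
    (hq : 0 < q) (K : ℝ≥0∞) (c L I : ι → ℝ≥0∞) :
    (K * ∏ i, (c i * (2 * L i) * I i) ^ (q / P i)) ^ (1 / q) =
      K ^ (1 / q) * (∏ i, (c i * 2) ^ (1 / P i)) * (∏ i, L i ^ (1 / P i)) *
        ∏ i, I i ^ (1 / P i) := by
  have hfactor (i : ι) : ((c i * (2 * L i) * I i) ^ (q / P i)) ^ (1 / q) =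
      (c i * 2) ^ (1 / P i) * L i ^ (1 / P i) * I i ^ (1 / P i) := by
    have hi : 0 ≤ 1 / P i := one_div_nonneg.2 (hP i).le
    rw [← ENNReal.rpow_mul, div_mul_div_comm, mul_comm q, mul_div_mul_right _ _ hq.ne',
      ← mul_assoc, ENNReal.mul_rpow_of_nonneg _ _ hi, ENNReal.mul_rpow_of_nonneg _ _ hi]
  have hq' : 0 ≤ 1 / q := by positivity
  rw [ENNReal.mul_rpow_of_nonneg _ _ hq', ← ENNReal.prod_rpow_of_nonneg hq']
  simp_rw [hfactor, Finset.prod_mul_distrib, mul_assoc]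

/-- The constant of the main estimate: `6 ^ n` is the loss of volume when a cube is replaced by a
dyadic one, `2 ^ n` the number of grids, `2 ^ m` the loss in the passage to principal cubes, and the
product comes from the Carleson embedding theorems. -/
noncomputable def maximalConst (n : ℕ) (P : Fin m → ℝ) (q α : ℝ) : ℝ≥0∞ :=
  (((6 ^ n) ^ (m - α / n)) ^ q * 2 ^ n * (2 ^ m) ^ q) ^ (1 / q) *
    ∏ i, (carlesonConst (P i) * 2) ^ (1 / P i)

theorem maximalConst_ne_top (hP : ∀ i, 0 ≤ P i) (hq : 0 ≤ q) :
    maximalConst n P q α ≠ ∞ := by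
  have hprod : ∏ i, (carlesonConst (P i) * 2) ^ (1 / P i) ≠ ∞ := ENNReal.prod_ne_top fun i _ =>
    ENNReal.rpow_ne_top_of_nonneg (one_div_nonneg.2 (hP i))
      (ENNReal.mul_ne_top (carlesonConst_ne_top (hP i)) ENNReal.ofNat_ne_top)
  have hq' : 0 ≤ 1 / q := one_div_nonneg.2 hq
  unfold maximalConst
  finiteness

theorem eLpNorm_fractionalMaximal_le (hP : ∀ i, 1 < P i) (hα : 0 ≤ α) (hq : 0 < q)
    (hαq : 1 / q = ∑ i, 1 / P i - α / n) {ω : Fin m → (Fin n → ℝ) → ℝ≥0} (hω : MemA P q ω)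
    {f : Fin m → (Fin n → ℝ) → ℂ} (hf : ∀ i, LocallyIntegrable (f i)) :
    eLpNorm (fractionalMaximal α f) (ENNReal.ofReal q) (powMeasure (prodWeight ω) q) ≤
      maximalConst n P q α * aConst P q ω ^ (1 / q) *
        (∏ i, aInftyConst (dualWeight (P i) (ω i)) ^ (1 / P i)) *
        ∏ i, eLpNorm (f i) (ENNReal.ofReal (P i)) (powMeasure (fun x => ω i x) (P i)) := by
  have hP0 (i : Fin m) : 0 < P i := one_pos.trans (hP i)
  have hf_norm (i : Fin m) := eLpNorm_ofReal_eq_lintegral_rpow_enorm (f i)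
    (powMeasure (fun x => ω i x) (P i)) (hP0 i)
  simp_rw [eLpNorm_ofReal_eq_lintegral_rpow_enorm _ _ hq, enorm_eq_self, hf_norm]
  refine (ENNReal.rpow_le_rpow (lintegral_fractionalMaximal_rpow_le hP hα hq hαq hω hf)
    (by positivity)).trans_eq ?_
  rw [mul_prod_rpow_rpow_one_div hP0 hq, ENNReal.mul_rpow_of_nonneg _ _ (by positivity),
    maximalConst]
  ring

end Maximal

end MultilinearFractional

open MultilinearFractional in
theorem corollary1p3_general (n m : ℕ) (P : Fin m → ℝ) (p q α : ℝ)
    (hP : ∀ i, 1 < P i) (hp : 1 / p = ∑ i, 1 / P i) (hp0 : 0 < p)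
    (hα : 0 ≤ α) (hαp : α * p < n) (hq : 1 / q = 1 / p - α / n) :
    ∃ C : ℝ≥0, ∀ ω : Fin m → (Fin n → ℝ) → ℝ≥0, MemA P q ω →
      ∀ f : Fin m → (Fin n → ℝ) → ℂ, (∀ i, LocallyIntegrable (f i) volume) →
        eLpNorm (fractionalMaximal α f) (ENNReal.ofReal q) (powMeasure (prodWeight ω) q)
          ≤ (C : ℝ≥0∞) * aConst P q ω ^ (1 / q) *
            (∏ i, aInftyConst (dualWeight (P i) (ω i)) ^ (1 / P i)) *
            ∏ i, eLpNorm (f i) (ENNReal.ofReal (P i))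
              (powMeasure (fun x => (ω i x : ℝ≥0∞)) (P i)) := by
  have hn : (0 : ℝ) < n := (mul_nonneg hα hp0.le).trans_lt hαp
  have hq0 : 0 < q := by
    rw [← one_div_pos, hq, sub_pos, div_lt_div_iff₀ hn hp0]
    linarith
  have hC : maximalConst n P q α ≠ ∞ :=
    maximalConst_ne_top (fun i => (one_pos.trans (hP i)).le) hq0.le
  refine ⟨(maximalConst n P q α).toNNReal, fun ω hω f hf => ?_⟩
  rw [ENNReal.coe_toNNReal hC]
  exact eLpNorm_fractionalMaximal_le hP hα hq0 (hp ▸ hq) hω hf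

theorem corollary1p3 (n m : ℕ) (P : Fin m → ℝ) (p q α : ℝ)
    (hP : ∀ i, 1 < P i) (hp : 1 / p = ∑ i, 1 / P i)
    (hα : 0 < α) (hαmn : α < (m : ℝ) * n)
    (hp_lower : 1 / (m : ℝ) < p) (hp_upper : p < (n : ℝ) / α)
    (hq : 1 / q = 1 / p - α / n) :
    ∃ C : ℝ≥0, ∀ ω : Fin m → (Fin n → ℝ) → ℝ≥0, MultilinearFractional.MemA P q ω →
      ∀ f : Fin m → (Fin n → ℝ) → ℂ, (∀ i, LocallyIntegrable (f i) volume) →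
        eLpNorm (MultilinearFractional.fractionalMaximal α f) (ENNReal.ofReal q)
            (MultilinearFractional.powMeasure (MultilinearFractional.prodWeight ω) q)
          ≤ (C : ℝ≥0∞) * MultilinearFractional.aConst P q ω ^ (1 / q) *
            (∏ i, MultilinearFractional.aInftyConst
                (MultilinearFractional.dualWeight (P i) (ω i)) ^ (1 / P i)) *
            ∏ i, eLpNorm (f i) (ENNReal.ofReal (P i))
              (MultilinearFractional.powMeasure (fun x => (ω i x : ℝ≥0∞)) (P i)) :=
  corollary1p3_general n m P p q α hP hp
    (lt_of_le_of_lt (by positivity) hp_lower) hα.le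
    (by rwa [mul_comm, ← lt_div_iff₀ hα]) hq
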